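/- Let $\mathcal H_v$ and $\mathcal H_h$ be finite-dimensional nonzero complex Hilbert spaces (the visible and the hidden system), let $(|x\rangle)_x$ be an orthonormal basis of $\mathcal H_h$, let $J\in\mathbb N$, and for $j=1,\dots,J$ and every $x$ let $G_v^{j,x}$ be a Hermitian operator on $\mathcal H_v$. For $\theta\in\mathbb R^J$ put $$G_j:=\sum_x G_v^{j,x}\otimes|x\rangle\!\langle x|,\quad G(\theta):=\sum_{j=1}^J\theta_jG_j,\quad \sigma_{vh}(\theta):=\frac{e^{-G(\theta)}}{\operatorname{Tr}[e^{-G(\theta)}]},\quad \sigma_v(\theta):=\operatorname{Tr}_h[\sigma_{vh}(\theta)],$$ $$G_v^x(\theta):=\sum_{j=1}^J\theta_jG_v^{j,x},\quad \sigma_v^x(\theta):=\frac{e^{-G_v^x(\theta)}}{\operatorname{Tr}[e^{-G_v^x(\theta)}]},\quad p_x(\theta):=\frac{\operatorname{Tr}[e^{-G_v^x(\theta)}]}{\operatorname{Tr}[e^{-G(\theta)}]}.$$ Then $\sigma_v(\theta)=\sum_x p_x(\theta)\,\sigma_v^x(\theta)$. Moreover, let $\rho$ be a quantum state on $\mathcal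 H_v$ (a positive semidefinite operator of trace one), let $D(\rho\|\sigma):=\operatorname{Tr}[\rho\ln\rho]-\operatorname{Tr}[\rho\ln\sigma]$ be the quantum relative entropy, and write $\langle A\rangle_\omega:=\operatorname{Tr}[A\omega]$ and $\{A,B\}:=AB+BA$. Then for every $\theta\in\mathbb R^J$ and every $j$ the partial derivative of $D(\rho\|\sigma_v(\theta))$ with respect to $\theta_j$ exists and $$\frac{\partial}{\partial\theta_j}D(\rho\|\sigma_v(\theta))=\sum_x p_x(\theta)\,\langle G_v^{j,x}\rangle_{\Sigma_v^{\theta,x}(\rho)}-\sum_x p_x(\theta)\,\langle G_v^{j,x}\rangle_{\sigma_v^x(\theta)},$$ where $\Sigma_v^{\theta,x}:=\Phi_v^{\theta,x}\circ\Xi_v^{\theta,x}\circ\Upsilon_v^{\theta}$ and $$\Xi_v^{\theta,x}(R):=\tfrac12\left\{\sigma_v^x(\theta),\ \sigma_v(\theta)^{-1/2}R\,\sigma_v(\theta)^{-1/2}\right\},$$ $$\Phi_v^{\theta,x}(Y):=\int_{-\infty}^{\infty}\gamma(t)\,e^{-iG_v^x(\theta)t}\,Y\,e^{iG_v^x(\theta)t}\,dt,\qquad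 \Upsilon_v^{\theta}(Y):=\int_{-\infty}^{\infty}\beta(t)\,\sigma_v(\theta)^{-it/2}\,Y\,\sigma_v(\theta)^{it/2}\,dt,$$ with the probability densities $\gamma(t):=\frac{2}{\pi}\ln\left|\coth\left(\frac{\pi t}{2}\right)\right|$ and $\beta(t):=\frac{\pi}{2(\cosh(\pi t)+1)}$ on $\mathbb R$. -/

import Mathlib

open scoped Kronecker ComplexOrder

namespace QCBoltzmann

noncomputable section

/-- The anticommutator `{A, B} = AB + BA`. -/
def anticomm {n : Type*} [Fintype n] (A B : Matrix n n ℂ) : Matrix n n ℂ :=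
  A * B + B * A

/-- The expectation value `⟨A⟩_ρ = Tr[A ρ]`. -/
def expval {n : Type*} [Fintype n] (A ρ : Matrix n n ℂ) : ℂ :=
  (A * ρ).trace

/-- A quantum state (density matrix): positive semidefinite with unit trace. -/
def IsState {n : Type*} [Fintype n] (ρ : Matrix n n ℂ) : Prop :=
  ρ.PosSemidef ∧ ρ.trace = 1

/-- The natural logarithm of a Hermitian matrix, by functional calculus.
Since `Real.log 0 = 0`, the product `ρ * matLog ρ` follows the convention `0 ln 0 = 0`. -/
def matLog {n : Type*} [Fintype n] [DecidableEq n] (A : Matrix n n ℂ) : Matrix n n ℂ :=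
  cfc Real.log A

/-- The complex power `A ^ w = exp (w ln A)` of a positive definite matrix. -/
def matPow {n : Type*} [Fintype n] [DecidableEq n] (A : Matrix n n ℂ) (w : ℂ) : Matrix n n ℂ :=
  NormedSpace.exp (w • matLog A)

/-- The Umegaki relative entropy `Tr[ρ ln ρ] - Tr[ρ ln σ]` of a state `ρ` with respect to a
positive definite state `σ` (it is then a real number, so nothing is lost in the real part). -/
def relEntropy {n : Type*} [Fintype n] [DecidableEq n] (ρ σ : Matrix n n ℂ) : ℝ :=
  ((ρ * matLog ρ).trace - (ρ * matLog σ).trace).re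

/-- The thermal state `exp (-B) / Tr[exp (-B)]`. -/
def thermalState {n : Type*} [Fintype n] [DecidableEq n] (B : Matrix n n ℂ) : Matrix n n ℂ :=
  (NormedSpace.exp (-B)).trace⁻¹ • NormedSpace.exp (-B)

/-- The partial trace over the second tensor factor. -/
def partialTraceRight {V H : Type*} [Fintype H] (M : Matrix (V × H) (V × H) ℂ) : Matrix V V ℂ :=
  Matrix.of fun a b => ∑ h, M (a, h) (b, h)

/-- The rank-one operator `|ψ⟩⟨ψ|`. -/
def ketbra {H : Type*} (ψ : EuclideanSpace ℂ H) : Matrix H H ℂ :=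
  Matrix.of fun k l => ψ k * star (ψ l)

/-- The integral over the real line of a matrix-valued function, entry by entry. -/
def matIntegral {n : Type*} (F : ℝ → Matrix n n ℂ) : Matrix n n ℂ :=
  Matrix.of fun a b => ∫ t : ℝ, F t a b

/-- The high-peak tent probability density `γ(t) = (2/π) ln |coth (π t / 2)|`. -/
def tentDensity (t : ℝ) : ℝ :=
  2 / Real.pi * Real.log |Real.cosh (Real.pi * t / 2) / Real.sinh (Real.pi * t / 2)|

/-- The logistic probability density `β(t) = π / (2 (cosh (π t) + 1))`. -/
def logisticDensity (t : ℝ) : ℝ :=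
  Real.pi / (2 * (Real.cosh (Real.pi * t) + 1))

section Model

variable {V H X : Type*} [Fintype V] [DecidableEq V] [Fintype H] [DecidableEq H] [Fintype X]
  {J : ℕ}

/-- The term `G_j = ∑ x, G_v^{j,x} ⊗ |x⟩⟨x|` of a quantum–classical Hamiltonian, where
`e` is the orthonormal basis `(|x⟩)_x` of the hidden space. -/
def hamTerm (e : OrthonormalBasis X ℂ (EuclideanSpace ℂ H)) (Gv : Fin J → X → Matrix V V ℂ)
    (j : Fin J) : Matrix (V × H) (V × H) ℂ :=
  ∑ x, Gv j x ⊗ₖ ketbra (e x)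

/-- The Hamiltonian `G(θ) = ∑ j, θ_j G_j` on the visible and hidden systems. -/
def hamiltonian (e : OrthonormalBasis X ℂ (EuclideanSpace ℂ H)) (Gv : Fin J → X → Matrix V V ℂ)
    (θ : Fin J → ℝ) : Matrix (V × H) (V × H) ℂ :=
  ∑ j, (θ j : ℂ) • hamTerm e Gv j

/-- The thermal state `σ_vh(θ)` of the quantum–classical Boltzmann machine. -/
def sigmaVH (e : OrthonormalBasis X ℂ (EuclideanSpace ℂ H)) (Gv : Fin J → X → Matrix V V ℂ)
    (θ : Fin J → ℝ) : Matrix (V × H) (V × H) ℂ :=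
  thermalState (hamiltonian e Gv θ)

/-- The reduced state `σ_v(θ) = Tr_h[σ_vh(θ)]` of the visible system. -/
def sigmaV (e : OrthonormalBasis X ℂ (EuclideanSpace ℂ H)) (Gv : Fin J → X → Matrix V V ℂ)
    (θ : Fin J → ℝ) : Matrix V V ℂ :=
  partialTraceRight (sigmaVH e Gv θ)

/-- The visible Hamiltonian `G_v^x(θ) = ∑ j, θ_j G_v^{j,x}`. -/
def visHamiltonian (Gv : Fin J → X → Matrix V V ℂ) (θ : Fin J → ℝ) (x : X) : Matrix V V ℂ :=
  ∑ j, (θ j : ℂ) • Gv j x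

/-- The visible thermal state `σ_v^x(θ)`. -/
def sigmaVx (Gv : Fin J → X → Matrix V V ℂ) (θ : Fin J → ℝ) (x : X) : Matrix V V ℂ :=
  thermalState (visHamiltonian Gv θ x)

/-- The probability `p_x(θ) = Tr[exp (-G_v^x(θ))] / Tr[exp (-G(θ))]` (both traces are real). -/
def prob (e : OrthonormalBasis X ℂ (EuclideanSpace ℂ H)) (Gv : Fin J → X → Matrix V V ℂ)
    (θ : Fin J → ℝ) (x : X) : ℝ :=
  (NormedSpace.exp (-visHamiltonian Gv θ x)).trace.re /
    (NormedSpace.exp (-hamiltonian e Gv θ)).trace.re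

/-- `Υ_v^θ(Y) = ∫ dt β(t) σ_v(θ)^{-it/2} Y σ_v(θ)^{it/2}`. -/
def upsilonMap (e : OrthonormalBasis X ℂ (EuclideanSpace ℂ H)) (Gv : Fin J → X → Matrix V V ℂ)
    (θ : Fin J → ℝ) (Y : Matrix V V ℂ) : Matrix V V ℂ :=
  matIntegral fun t => (logisticDensity t : ℂ) •
    (matPow (sigmaV e Gv θ) (-(Complex.I * t / 2)) * Y *
      matPow (sigmaV e Gv θ) (Complex.I * t / 2))

/-- `Ξ_v^{θ,x}(R) = (1/2) {σ_v^x(θ), σ_v(θ)^{-1/2} R σ_v(θ)^{-1/2}}`. -/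
def xiMap (e : OrthonormalBasis X ℂ (EuclideanSpace ℂ H)) (Gv : Fin J → X → Matrix V V ℂ)
    (θ : Fin J → ℝ) (x : X) (R : Matrix V V ℂ) : Matrix V V ℂ :=
  (1 / 2 : ℂ) • anticomm (sigmaVx Gv θ x)
    (matPow (sigmaV e Gv θ) (-(1 / 2)) * R * matPow (sigmaV e Gv θ) (-(1 / 2)))

/-- `Φ_v^{θ,x}(Y) = ∫ dt γ(t) exp (-i G_v^x(θ) t) Y exp (i G_v^x(θ) t)`. -/
def phiMap (Gv : Fin J → X → Matrix V V ℂ) (θ : Fin J → ℝ) (x : X) (Y : Matrix V V ℂ) :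
    Matrix V V ℂ :=
  matIntegral fun t => (tentDensity t : ℂ) •
    (NormedSpace.exp (-(Complex.I * t) • visHamiltonian Gv θ x) * Y *
      NormedSpace.exp ((Complex.I * t) • visHamiltonian Gv θ x))

/-- `Σ_v^{θ,x} = Φ_v^{θ,x} ∘ Ξ_v^{θ,x} ∘ Υ_v^θ`. -/
def sigmaMap (e : OrthonormalBasis X ℂ (EuclideanSpace ℂ H)) (Gv : Fin J → X → Matrix V V ℂ)
    (θ : Fin J → ℝ) (x : X) : Matrix V V ℂ → Matrix V V ℂ :=
  phiMap Gv θ x ∘ xiMap e Gv θ x ∘ upsilonMap e Gv θ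

end Model

end

end QCBoltzmann

namespace QCBoltzmann

section

open MeasureTheory Set Filter Topology Complex

/-! ### Fourier transform of the logistic density -/

/-! `G(θ)` is block diagonal in the hidden basis, so its exponential is the sum of the blocks `exp
(-G_v^x) ⊗ |x⟩⟨x|` (`exp_blockHom`). Tracing out the hidden system gives `σ_v = W / Tr W` with `W =
∑ x, exp (-G_v^x)`; the mixture formula is this identity with each block normalised.

For the gradient, only `-Tr[ρ ln σ_v]` depends on `θ`. At a Hermitian matrix with eigenvalues `a`,
the derivative of a power series `f` multiplies the `(k,l)` entry in the eigenbasis by the divided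
difference `f[a_k, a_l]` (`hasFDerivAt_tsum_smul_pow_conjDiag`). For distinct arguments, `exp[x, y]
= (e^x + e^y)/2 · tanh(w/2)/(w/2)` with `w = x - y`, and `ln[x, y] = x^{-1/2} y^{-1/2} · u / sinh u`
with `u = (ln y - ln x)/2`. The last factors are the Fourier transforms of `γ` and `β`
(`integral_tentDensity_mul_exp`, `integral_logisticDensity_mul_exp`), extended by 1 to coinciding
arguments. Averaged over its density, conjugation by a unitary group is entrywise multiplication by
such a transform. Hence the derivative of `exp` is half an anticommutator composed with `Φ`, and
that of `ln` is `Υ` between two factors `σ_v^{-1/2}`.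

The multipliers are symmetric, so these maps are self-adjoint for `Tr[AB]` and can be moved onto `ρ`
and onto `G_v^{j,x}`. With `R = σ_v^{-1/2} Υ(ρ) σ_v^{-1/2}`, the derivative of `W` yields the first
sum; that of `1 / Tr W` yields the second, because `Tr[R σ_v] = Tr ρ = 1`. -/

theorem logisticDensity_eq_sigmoid (t : ℝ) :
    logisticDensity t =
      Real.pi * (Real.sigmoid (Real.pi * t) * (1 - Real.sigmoid (Real.pi * t))) := by
  have h := Real.exp_pos (Real.pi * t)
  rw [logisticDensity, Real.cosh_eq, Real.sigmoid_def, Real.exp_neg]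
  field_simp
  ring

/-- `β` is the density of a logistic law with this distribution function, so the substitution turns
integrals against `β` into integrals over `(0, 1)`. -/
theorem hasDerivAt_sigmoid_pi (t : ℝ) :
    HasDerivAt (fun t => Real.sigmoid (Real.pi * t)) (logisticDensity t) t := by
  have h := (Real.hasDerivAt_sigmoid (Real.pi * t)).comp t ((hasDerivAt_id t).const_mul Real.pi)
  rw [logisticDensity_eq_sigmoid]
  exact h.congr_deriv (by ring)

theorem logisticDensity_nonneg (t : ℝ) : 0 ≤ logisticDensity t := by
  have := Real.cosh_pos (Real.pi * t)
  unfold logisticDensity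
  positivity

theorem image_sigmoid_pi : (fun t => Real.sigmoid (Real.pi * t)) '' univ = Ioo 0 1 := by
  rw [image_univ, ← Real.range_sigmoid]
  exact (mul_left_surjective₀ Real.pi_ne_zero).range_comp Real.sigmoid

theorem injOn_sigmoid_pi : InjOn (fun t => Real.sigmoid (Real.pi * t)) univ := fun _ _ _ _ h =>
  mul_left_cancel₀ Real.pi_ne_zero (Real.sigmoid_injective h)

theorem integrable_logisticDensity : Integrable logisticDensity := by
  have h := (integrableOn_image_iff_integrableOn_abs_deriv_smul MeasurableSet.univ
    (fun t _ => (hasDerivAt_sigmoid_pi t).hasDerivWithinAt) injOn_sigmoid_pi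
    (fun _ => (1 : ℝ))).1 (by rw [image_sigmoid_pi]; exact integrableOn_const (by simp))
  rw [integrableOn_univ] at h
  refine h.congr (.of_forall fun t => ?_)
  simp [abs_of_nonneg (logisticDensity_nonneg t)]

theorem sigmoid_cpow_mul (s : ℝ) (z : ℂ) :
    (Real.sigmoid s : ℂ) ^ z * (1 - (Real.sigmoid s : ℂ)) ^ (-z) = cexp (s * z) := by
  have h1 := Real.sigmoid_pos s
  have h2 : 0 < 1 - Real.sigmoid s := sub_pos.2 (Real.sigmoid_lt_one s)
  have h3 : Real.sigmoid s = Real.exp s * (1 - Real.sigmoid s) := by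
    rw [← Real.sigmoid_neg, ← Real.sigmoid_mul_rexp_neg, mul_left_comm, ← Real.exp_add]
    simp
  have h4 : Real.log (Real.sigmoid s) = s + Real.log (1 - Real.sigmoid s) := by
    conv_lhs => rw [h3, Real.log_mul (Real.exp_pos s).ne' h2.ne', Real.log_exp]
  have e2 : (1 - (Real.sigmoid s : ℂ)) = ((1 - Real.sigmoid s : ℝ) : ℂ) := by push_cast; ring
  rw [e2, cpow_def_of_ne_zero (by exact_mod_cast h1.ne'),
    cpow_def_of_ne_zero (by exact_mod_cast h2.ne'), ← ofReal_log h1.le, ← ofReal_log h2.le, h4,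
    ← Complex.exp_add]
  congr 1
  push_cast
  ring

/-- With `s = sigmoid (π t)`, the character `exp (iwt)` becomes `(s / (1 - s)) ^ (iw/π)`. -/
theorem integral_logisticDensity_eq_betaIntegral (w : ℝ) :
    ∫ t : ℝ, (logisticDensity t : ℂ) * cexp (I * w * t) =
      betaIntegral (1 + I * (w / Real.pi)) (1 - I * (w / Real.pi)) := by
  have h := integral_image_eq_integral_abs_deriv_smul MeasurableSet.univ
    (fun t _ => (hasDerivAt_sigmoid_pi t).hasDerivWithinAt) injOn_sigmoid_pi
    (fun x : ℝ =>
      (x : ℂ) ^ (1 + I * (w / Real.pi) - 1) * (1 - (x : ℂ)) ^ (1 - I * (w / Real.pi) - 1))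
  rw [image_sigmoid_pi, Measure.restrict_univ] at h
  rw [betaIntegral, intervalIntegral.integral_of_le zero_le_one, integral_Ioc_eq_integral_Ioo, h]
  congr 1 with t
  have e1 : 1 + I * (w / Real.pi) - 1 = I * ((w : ℂ) / Real.pi) := by ring
  have e2 : 1 - I * (w / Real.pi) - 1 = -(I * ((w : ℂ) / Real.pi)) := by ring
  rw [e1, e2, sigmoid_cpow_mul, abs_of_nonneg (logisticDensity_nonneg t), real_smul]
  congr 2
  have : (Real.pi : ℂ) ≠ 0 := by exact_mod_cast Real.pi_ne_zero
  push_cast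
  field_simp

/-- Euler's reflection formula `Γ(1 + z) Γ(1 - z) = πz / sin πz` at `z = iw/π`. The product form
with `sinh w` also covers `w = 0`. -/
theorem integral_logisticDensity_mul_exp (w : ℝ) :
    (∫ t : ℝ, (logisticDensity t : ℂ) * cexp (I * w * t)) * Real.sinh w = w := by
  have hpi : (Real.pi : ℂ) ≠ 0 := by exact_mod_cast Real.pi_ne_zero
  rcases eq_or_ne w 0 with rfl | hw
  · simp
  have hw' : (w : ℂ) ≠ 0 := by exact_mod_cast hw
  have hz : I * ((w : ℂ) / Real.pi) ≠ 0 := by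
    simp [hw, Real.pi_ne_zero]
  have h := Complex.Gamma_mul_Gamma_eq_betaIntegral (s := 1 + I * (w / Real.pi))
    (t := 1 - I * (w / Real.pi)) (by simp [← ofReal_div]) (by simp [← ofReal_div])
  have h2 : (1 + I * ((w : ℂ) / Real.pi)) + (1 - I * (w / Real.pi)) = 2 := by ring
  have h1 : Complex.Gamma (1 + I * ((w : ℂ) / Real.pi)) =
      I * (w / Real.pi) * Complex.Gamma (I * (w / Real.pi)) := by
    rw [add_comm, Complex.Gamma_add_one _ hz]
  rw [h2, h1, mul_assoc, Complex.Gamma_mul_Gamma_one_sub] at h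
  have h3 : (Real.pi : ℂ) * (I * (w / Real.pi)) = w * I := by field_simp
  rw [h3, Complex.sin_mul_I] at h
  have hs : Complex.sinh w ≠ 0 := by
    rw [← ofReal_sinh]; exact_mod_cast fun h => hw (Real.sinh_eq_zero.1 h)
  have hG : Complex.Gamma 2 = 1 := by
    have := Complex.Gamma_nat_eq_factorial 1
    rw [show (2 : ℂ) = ((1 : ℕ) : ℂ) + 1 by norm_num, this]
    simp
  rw [hG, one_mul] at h
  rw [integral_logisticDensity_eq_betaIntegral, ← h, ofReal_sinh]
  field_simp

theorem integral_logisticDensity : ∫ t : ℝ, (logisticDensity t : ℂ) = 1 := by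
  have h := integral_logisticDensity_eq_betaIntegral 0
  simpa [betaIntegral] using h

theorem integrable_mul_exp_I {f : ℝ → ℝ} (hf : Integrable f) (w : ℝ) :
    Integrable fun t : ℝ => (f t : ℂ) * cexp (I * w * t) := by
  refine hf.ofReal.mul_bdd (c := 1) (by fun_prop) (.of_forall fun t => ?_)
  have : I * w * t = ((w * t : ℝ) : ℂ) * I := by push_cast; ring
  rw [this, norm_exp_ofReal_mul_I]

end

section

open MeasureTheory Set Filter Topology Complex

/-! ### Fourier transform of the high-peak tent density -/

/-- With `x = exp (-π|t|)`, `|coth (πt/2)| = (1 + x)/(1 - x)`, whose logarithm is twice the sum of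
the odd powers `x^(2k+1)/(2k+1)`. -/
theorem hasSum_tentDensity {t : ℝ} (ht : t ≠ 0) :
    HasSum (fun k : ℕ => 4 / (Real.pi * (2 * k + 1)) * Real.exp (-((2 * k + 1) * Real.pi * |t|)))
      (tentDensity t) := by
  have hpi := Real.pi_pos
  set u : ℝ := |Real.pi * t / 2| with hu
  have hu0 : 0 < u := abs_pos.2 (by positivity)
  have hut : Real.pi * |t| = 2 * u := by
    rw [hu, abs_div, abs_mul, abs_of_pos hpi, abs_two]; ring
  have hx1 : Real.exp (-(2 * u)) < 1 := by
    rw [← Real.exp_zero]; exact Real.exp_lt_exp.2 (by linarith)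
  have hx0 := Real.exp_pos (-(2 * u))
  have h := (Real.hasSum_log_sub_log_of_abs_lt_one (x := Real.exp (-(2 * u)))
    (by rwa [abs_of_pos hx0])).mul_left (2 / Real.pi)
  have hlog : Real.log |Real.cosh (Real.pi * t / 2) / Real.sinh (Real.pi * t / 2)| =
      Real.log (1 + Real.exp (-(2 * u))) - Real.log (1 - Real.exp (-(2 * u))) := by
    rw [← Real.log_div (by positivity) (by linarith), abs_div, Real.abs_sinh,
      abs_of_pos (Real.cosh_pos _), ← Real.cosh_abs, ← hu]
    congr 1
    have e : Real.exp (-(2 * u)) = Real.exp (-u) * Real.exp (-u) := by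
      rw [← Real.exp_add]; ring_nf
    have e1 : Real.exp u * Real.exp (-u) = 1 := by rw [← Real.exp_add]; simp
    rw [div_eq_div_iff (Real.sinh_pos_iff.2 hu0).ne' (by linarith), Real.cosh_eq, Real.sinh_eq, e]
    linear_combination -Real.exp (-u) * e1
  rw [← hlog] at h
  refine h.congr_fun (fun k => ?_)
  rw [← Real.exp_nat_mul, mul_assoc (2 * (k : ℝ) + 1), hut]
  push_cast
  field_simp
  norm_num

theorem integral_exp_neg_mul_abs_mul_exp {c : ℝ} (hc : 0 < c) (w : ℝ) :
    Integrable (fun t : ℝ => (Real.exp (-(c * |t|)) : ℂ) * cexp (I * w * t)) ∧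
    ∫ t : ℝ, (Real.exp (-(c * |t|)) : ℂ) * cexp (I * w * t) = 2 * c / (c ^ 2 + w ^ 2) := by
  have e1 : EqOn (fun t : ℝ => (Real.exp (-(c * |t|)) : ℂ) * cexp (I * w * t))
      (fun t => cexp ((-c + I * w) * t)) (Ioi 0) := fun t ht => by
    simp only [abs_of_pos (show 0 < t from ht), ofReal_exp, ← Complex.exp_add]
    push_cast; ring_nf
  have e2 : EqOn (fun t : ℝ => (Real.exp (-(c * |t|)) : ℂ) * cexp (I * w * t))
      (fun t => cexp ((c + I * w) * t)) (Iic 0) := fun t ht => by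
    simp only [abs_of_nonpos (show t ≤ 0 from ht), ofReal_exp, ← Complex.exp_add]
    push_cast; ring_nf
  have r1 : (-c + I * w : ℂ).re < 0 := by simpa
  have r2 : 0 < (c + I * w : ℂ).re := by simpa
  have i1 := (integrableOn_exp_mul_complex_Ioi r1 0).congr_fun e1.symm measurableSet_Ioi
  have i2 := (integrableOn_exp_mul_complex_Iic r2 0).congr_fun e2.symm measurableSet_Iic
  refine ⟨by rw [← integrableOn_univ, ← Iic_union_Ioi (a := (0 : ℝ))]; exact i2.union i1, ?_⟩
  rw [← intervalIntegral.integral_Iic_add_Ioi i2 i1, setIntegral_congr_fun measurableSet_Ioi e1,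
    setIntegral_congr_fun measurableSet_Iic e2, integral_exp_mul_complex_Ioi r1,
    integral_exp_mul_complex_Iic r2]
  have n1 : (-c + I * w : ℂ) ≠ 0 := fun h => by simp [h] at r1
  have n2 : (c + I * w : ℂ) ≠ 0 := fun h => by simp [h] at r2
  have n3 : (c ^ 2 + w ^ 2 : ℂ) ≠ 0 := by exact_mod_cast (by positivity : c ^ 2 + w ^ 2 ≠ 0)
  simp only [ofReal_zero, mul_zero, Complex.exp_zero]
  field_simp
  ring_nf
  simp only [I_sq]
  ring

/-- The odd part of the Basel sum. It serves both to justify termwise integration of the tent series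
and to normalise `γ`. -/
theorem hasSum_odd_inv_sq :
    HasSum (fun k : ℕ => 8 / (Real.pi ^ 2 * (2 * k + 1 : ℝ) ^ 2)) 1 := by
  have h := hasSum_zeta_two
  have hodd : Summable fun k : ℕ => (1 : ℝ) / ((2 * k + 1 : ℕ) : ℝ) ^ 2 :=
    h.summable.comp_injective (i := fun k => 2 * k + 1) fun a b hab => by simpa using hab
  have heven : HasSum (fun k : ℕ => (1 : ℝ) / ((2 * k : ℕ) : ℝ) ^ 2)
      (1 / 4 * (Real.pi ^ 2 / 6)) := by
    refine (h.mul_left (1 / 4)).congr_fun fun k => ?_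
    push_cast
    rw [mul_pow, div_mul_div_comm]; norm_num
  have h3 := (HasSum.even_add_odd (f := fun n : ℕ => (1 : ℝ) / (n : ℝ) ^ 2)
    heven hodd.hasSum).unique h
  have h4 := hodd.hasSum.mul_left (8 / Real.pi ^ 2)
  have hpi := Real.pi_ne_zero
  have e : 8 / Real.pi ^ 2 * ∑' k : ℕ, (1 : ℝ) / ((2 * k + 1 : ℕ) : ℝ) ^ 2 = 1 := by
    rw [← eq_sub_iff_add_eq'] at h3
    rw [h3]; field_simp; norm_num
  rw [e] at h4
  refine h4.congr_fun fun k => ?_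
  push_cast
  field_simp

theorem hasSum_integral_tentDensity (w : ℝ) :
    HasSum (fun k : ℕ => (8 / (((2 * k + 1) * Real.pi) ^ 2 + w ^ 2) : ℂ))
      (∫ t : ℝ, (tentDensity t : ℂ) * cexp (I * w * t)) := by
  have hpi := Real.pi_pos
  have hc : ∀ k : ℕ, 0 < (2 * k + 1) * Real.pi := fun k => by positivity
  have hint := fun k : ℕ => integral_exp_neg_mul_abs_mul_exp (hc k) w
  have hnorm : ∀ (k : ℕ) (t : ℝ), ‖((4 / (Real.pi * (2 * k + 1)) : ℝ) : ℂ) *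
      ((Real.exp (-((2 * k + 1) * Real.pi * |t|)) : ℂ) * cexp (I * w * t))‖ =
      4 / (Real.pi * (2 * k + 1)) * Real.exp (-((2 * k + 1) * Real.pi * |t|)) := fun k t => by
    have : I * w * t = ((w * t : ℝ) : ℂ) * I := by push_cast; ring
    rw [norm_mul, norm_mul, this, norm_exp_ofReal_mul_I, mul_one, norm_real, norm_real,
      Real.norm_of_nonneg (by positivity), Real.norm_of_nonneg (by positivity)]
  have hsum : Summable fun k : ℕ => ∫ t : ℝ, ‖((4 / (Real.pi * (2 * k + 1)) : ℝ) : ℂ) *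
      ((Real.exp (-((2 * k + 1) * Real.pi * |t|)) : ℂ) * cexp (I * w * t))‖ := by
    -- The norms do not see the character, so their integrals are the terms at `w = 0`.
    refine hasSum_odd_inv_sq.summable.congr fun k => ?_
    simp_rw [hnorm]
    rw [integral_const_mul]
    have h := (integral_exp_neg_mul_abs_mul_exp (hc k) 0).2
    simp only [ofReal_zero, mul_zero, zero_mul, Complex.exp_zero, mul_one] at h
    rw [integral_complex_ofReal] at h
    have h' : ∫ t : ℝ, Real.exp (-((2 * k + 1) * Real.pi * |t|)) =
        2 * ((2 * k + 1) * Real.pi) / (((2 * k + 1) * Real.pi) ^ 2 + 0 ^ 2) := by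
      exact_mod_cast h
    rw [h']
    field_simp
    ring
  have h := hasSum_integral_of_summable_integral_norm
    (fun k : ℕ => (hint k).1.const_mul ((4 / (Real.pi * (2 * k + 1)) : ℝ) : ℂ)) hsum
  have hlim : ∫ t : ℝ, (tentDensity t : ℂ) * cexp (I * w * t) =
      ∫ t : ℝ, ∑' k : ℕ, ((4 / (Real.pi * (2 * k + 1)) : ℝ) : ℂ) *
      ((Real.exp (-((2 * k + 1) * Real.pi * |t|)) : ℂ) * cexp (I * w * t)) := by
    refine integral_congr_ae ?_
    -- The expansion is available only off the logarithmic singularity at `t = 0`, a null set.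
    filter_upwards [compl_mem_ae_iff.2 (measure_singleton (0 : ℝ))] with t ht
    have h := ((hasSum_ofReal.2 (hasSum_tentDensity ht)).mul_right (cexp (I * w * t))).tsum_eq
    rw [← h]
    congr 1 with k
    push_cast
    ring
  rw [hlim]
  refine h.congr_fun fun k => ?_
  rw [integral_const_mul, (hint k).2]
  have : (((2 * k + 1) * Real.pi : ℝ) : ℂ) ^ 2 + (w : ℂ) ^ 2 ≠ 0 := by
    exact_mod_cast (by have := hc k; positivity : ((2 * k + 1) * Real.pi) ^ 2 + w ^ 2 ≠ 0)
  have hp : (Real.pi : ℂ) ≠ 0 := by exact_mod_cast hpi.ne'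
  have hk : (2 * k + 1 : ℂ) ≠ 0 := by exact_mod_cast (by positivity : (2 * k + 1 : ℝ) ≠ 0)
  push_cast at this ⊢
  field_simp
  norm_num

theorem integral_tentDensity : ∫ t : ℝ, (tentDensity t : ℂ) = 1 := by
  have h := hasSum_integral_tentDensity 0
  simp only [ofReal_zero, mul_zero, zero_mul, Complex.exp_zero, mul_one] at h
  refine h.unique ?_
  refine (hasSum_ofReal.2 hasSum_odd_inv_sq).congr_fun fun k => ?_
  push_cast
  ring

/-- The Bochner integral of a non-integrable function is 0, while this one is 1. -/
theorem integrable_tentDensity : Integrable tentDensity := by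
  refine Integrable.of_integral_ne_zero ?_
  have h := integral_tentDensity
  rw [integral_complex_ofReal] at h
  intro h0
  simp [h0] at h

theorem mem_integerComplement_of_im_ne_zero {z : ℂ} (hz : z.im ≠ 0) :
    z ∈ Complex.integerComplement := by
  rintro ⟨n, rfl⟩
  simp at hz

theorem hasSum_odd_cotTerm {z q : ℂ} (hz : z.im ≠ 0) (hq : cexp (2 * I * (Real.pi * z)) = q)
    (hq1 : 1 - q ≠ 0) (hq2 : 1 + q ≠ 0) :
    HasSum (fun k : ℕ => 1 / (2 * z - (2 * k + 1)) + 1 / (2 * z + (2 * k + 1)))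
      (Real.pi * (1 - q) / (2 * I * (1 + q))) := by
  have hz1 := mem_integerComplement_of_im_ne_zero hz
  have hz2 : 2 * z ∈ Complex.integerComplement :=
    mem_integerComplement_of_im_ne_zero (by simpa using hz)
  have hz0 : z ≠ 0 := fun h => by simp [h] at hz
  -- These are the cotangent terms at `2z`. Because of the shift `n + 1`, even indices carry the odd
  -- integers, which are wanted; odd indices give half the cotangent series at `z`, to be
  -- subtracted.
  obtain ⟨f, hf⟩ : ∃ f : ℕ → ℂ, f = fun n : ℕ => 1 / (2 * z - (n + 1)) + 1 / (2 * z + (n + 1)) :=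
    ⟨_, rfl⟩
  have s2 : Summable f := by rw [hf]; exact summable_cotTerm hz2
  have se : Summable fun k => f (2 * k) :=
    s2.comp_injective (i := fun k => 2 * k) fun a b hab => by simpa using hab
  have so : Summable fun k => f (2 * k + 1) :=
    s2.comp_injective (i := fun k => 2 * k + 1) fun a b hab => by simpa using hab
  have hsplit := tsum_even_add_odd se so
  have hodd : ∑' k : ℕ, f (2 * k + 1) = 1 / 2 * (Real.pi * Complex.cot (Real.pi * z) - 1 / z) := by
    rw [cot_series_rep' hz1, ← tsum_mul_left]
    congr 1 with k
    have e1 : 2 * z - (((2 * k + 1 : ℕ) : ℂ) + 1) = 2 * (z - (k + 1)) := by push_cast; ring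
    have e2 : 2 * z + (((2 * k + 1 : ℕ) : ℂ) + 1) = 2 * (z + (k + 1)) := by push_cast; ring
    simp only [hf, e1, e2, one_div, mul_inv]
    ring
  have hall : ∑' k : ℕ, f k = Real.pi * Complex.cot (Real.pi * (2 * z)) - 1 / (2 * z) := by
    rw [cot_series_rep' hz2, hf]
  have q2 : cexp (2 * I * (Real.pi * (2 * z))) = q ^ 2 := by
    rw [← hq, ← Complex.exp_nat_mul]
    congr 1
    push_cast
    ring
  rw [hodd, hall, Complex.cot_eq_exp_ratio,
    Complex.cot_eq_exp_ratio, hq, q2] at hsplit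
  have hfac : 1 - q ^ 2 = (1 - q) * (1 + q) := by ring
  have hval : ∑' k : ℕ, f (2 * k) = Real.pi * (1 - q) / (2 * I * (1 + q)) := by
    rw [eq_sub_of_add_eq hsplit, hfac]
    field_simp
    ring
  rw [← hval]
  refine se.hasSum.congr_fun fun k => ?_
  simp [hf]

theorem integral_tentDensity_mul_exp (w : ℝ) :
    (∫ t : ℝ, (tentDensity t : ℂ) * cexp (I * w * t)) * w * (1 + cexp (-w)) =
      2 * (1 - cexp (-w)) := by
  rcases eq_or_ne w 0 with rfl | hw
  · simp
  have hpi : (Real.pi : ℂ) ≠ 0 := by exact_mod_cast Real.pi_ne_zero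
  have hw' : (w : ℂ) ≠ 0 := by exact_mod_cast hw
  -- The point `z = iw/(2π)` makes `q = exp (2πiz) = exp (-w)`, and `2z ± (2k+1)` are, up to
  -- constants, the linear factors of `((2k+1)π)² + w²`.
  have hzim : (((w / (2 * Real.pi) : ℝ) : ℂ) * I).im ≠ 0 := by
    rw [im_ofReal_mul, I_im, mul_one]
    exact div_ne_zero hw (by positivity)
  have hq : (cexp (-w)) = ((Real.exp (-w) : ℝ) : ℂ) := by push_cast; rfl
  have hq1 : 1 - cexp (-w) ≠ 0 := by
    rw [hq, sub_ne_zero]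
    exact_mod_cast fun h => hw (by simpa using h.symm)
  have hq2 : 1 + cexp (-w) ≠ 0 := by
    rw [hq]
    exact_mod_cast (by positivity : 1 + Real.exp (-w) ≠ 0)
  have hcot := hasSum_odd_cotTerm hzim (q := cexp (-w)) (by
    congr 1
    push_cast
    field_simp
    rw [I_sq]) hq1 hq2
  have hint := (hasSum_integral_tentDensity w).unique
    ((hcot.mul_left (4 * I / (w * Real.pi))).congr_fun fun k => ?_)
  · rw [hint]
    field_simp
    ring
  have hk : ((2 * k + 1) * Real.pi : ℂ) ^ 2 + (w : ℂ) ^ 2 ≠ 0 := by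
    exact_mod_cast (by positivity : ((2 * k + 1) * Real.pi) ^ 2 + w ^ 2 ≠ 0)
  have e1 : 2 * (((w / (2 * Real.pi) : ℝ) : ℂ) * I) - (2 * (k : ℂ) + 1) =
      (I * w - (2 * k + 1) * Real.pi) / Real.pi := by
    push_cast; field_simp
  have e2 : 2 * (((w / (2 * Real.pi) : ℝ) : ℂ) * I) + (2 * (k : ℂ) + 1) =
      (I * w + (2 * k + 1) * Real.pi) / Real.pi := by
    push_cast; field_simp
  have e3 : (I * w - (2 * k + 1) * Real.pi) * (I * w + (2 * k + 1) * Real.pi) =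
      -(((2 * k + 1) * Real.pi : ℂ) ^ 2 + (w : ℂ) ^ 2) := by
    linear_combination (w : ℂ) ^ 2 * I_sq
  have n1 : (I * w - (2 * k + 1) * Real.pi : ℂ) ≠ 0 := fun h => by
    rw [h, zero_mul] at e3; exact hk (neg_eq_zero.1 e3.symm)
  have n2 : (I * w + (2 * k + 1) * Real.pi : ℂ) ≠ 0 := fun h => by
    rw [h, mul_zero] at e3; exact hk (neg_eq_zero.1 e3.symm)
  have e4 : Real.pi * (I * w + (2 * k + 1) * Real.pi) + (I * w - (2 * k + 1) * Real.pi) * Real.pi =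
      2 * Real.pi * I * w := by ring
  rw [e1, e2, one_div_div, one_div_div, div_add_div _ _ n1 n2, e3, e4]
  field_simp
  rw [I_sq]
  ring

end

section

open MeasureTheory Matrix

/-! ### Matrices in an eigenbasis -/

section Spectral

variable {n : Type*} [Fintype n] [DecidableEq n]

/-- The matrix with eigenvalues `d` in the orthonormal basis of the columns of `U`. -/
noncomputable def conjDiag (U : Matrix n n ℂ) (d : n → ℂ) : Matrix n n ℂ :=
  U * diagonal d * star U

/-- Entrywise multiplication by `φ` in the orthonormal basis of the columns of `U`. -/
noncomputable def schurMul (U : Matrix n n ℂ) (φ : n → n → ℂ) (Y : Matrix n n ℂ) : Matrix n n ℂ :=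
  U * Matrix.of (fun k l => φ k l * (star U * Y * U) k l) * star U

variable {U : Matrix n n ℂ} (hU : U ∈ unitaryGroup n ℂ)

include hU

theorem star_mul_conj_mul (M : Matrix n n ℂ) : star U * (U * M * star U) * U = M := by
  have h := mem_unitaryGroup_iff'.1 hU
  calc star U * (U * M * star U) * U = (star U * U) * M * (star U * U) := by
        simp only [Matrix.mul_assoc]
    _ = M := by rw [h, Matrix.one_mul, Matrix.mul_one]

theorem conj_star_mul_mul (M : Matrix n n ℂ) : U * (star U * M * U) * star U = M := by
  have h := mem_unitaryGroup_iff.1 hU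
  calc U * (star U * M * U) * star U = (U * star U) * M * (U * star U) := by
        simp only [Matrix.mul_assoc]
    _ = M := by rw [h, Matrix.one_mul, Matrix.mul_one]

/-- Reduces the identities below to entrywise identities in the eigenbasis. -/
theorem conj_injective {A B : Matrix n n ℂ} (h : star U * A * U = star U * B * U) : A = B := by
  rw [← conj_star_mul_mul hU A, h, conj_star_mul_mul hU B]

theorem star_mul_mul_mul (A B : Matrix n n ℂ) :
    star U * (A * B) * U = (star U * A * U) * (star U * B * U) := by
  have h := mem_unitaryGroup_iff.1 hU
  calc star U * (A * B) * U = star U * A * 1 * B * U := by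
        simp only [Matrix.mul_assoc, Matrix.one_mul]
    _ = _ := by rw [← h]; simp only [Matrix.mul_assoc]

theorem star_mul_conjDiag_mul (d : n → ℂ) : star U * conjDiag U d * U = diagonal d :=
  star_mul_conj_mul hU _

theorem star_mul_schurMul_mul (φ : n → n → ℂ) (Y : Matrix n n ℂ) :
    star U * schurMul U φ Y * U = Matrix.of fun k l => φ k l * (star U * Y * U) k l :=
  star_mul_conj_mul hU _

theorem schurMul_schurMul (φ ψ : n → n → ℂ) (Y : Matrix n n ℂ) :
    schurMul U φ (schurMul U ψ Y) = schurMul U (fun k l => φ k l * ψ k l) Y := by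
  refine conj_injective hU ?_
  simp only [star_mul_schurMul_mul hU]
  ext k l
  simp [mul_assoc]

theorem conjDiag_mul_mul_conjDiag (d e : n → ℂ) (Y : Matrix n n ℂ) :
    conjDiag U d * Y * conjDiag U e = schurMul U (fun k l => d k * e l) Y := by
  refine conj_injective hU ?_
  rw [star_mul_mul_mul hU, star_mul_mul_mul hU]
  simp only [star_mul_schurMul_mul hU, star_mul_conjDiag_mul hU]
  ext k l
  simp only [mul_diagonal, diagonal_mul, of_apply]
  ring

theorem anticomm_conjDiag (d : n → ℂ) (Y : Matrix n n ℂ) :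
    anticomm (conjDiag U d) Y = schurMul U (fun k l => d k + d l) Y := by
  refine conj_injective hU ?_
  rw [anticomm, Matrix.mul_add, Matrix.add_mul, star_mul_mul_mul hU, star_mul_mul_mul hU]
  simp only [star_mul_schurMul_mul hU, star_mul_conjDiag_mul hU]
  ext k l
  simp only [mul_diagonal, diagonal_mul, of_apply, Matrix.add_apply]
  ring

theorem schurMul_conjDiag (φ : n → n → ℂ) (d : n → ℂ) :
    schurMul U φ (conjDiag U d) = conjDiag U (fun k => φ k k * d k) := by
  refine conj_injective hU ?_
  simp only [star_mul_schurMul_mul hU, star_mul_conjDiag_mul hU]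
  ext k l
  by_cases h : k = l
  · subst h; simp
  · simp [h]

theorem trace_mul_eq_trace_conj (A B : Matrix n n ℂ) :
    (A * B).trace = ((star U * A * U) * (star U * B * U)).trace := by
  rw [← star_mul_mul_mul hU, trace_mul_comm (star U * _), ← Matrix.mul_assoc,
    mem_unitaryGroup_iff.1 hU, Matrix.one_mul]

/-- The pairing `Tr[AB]` matches entry `(k,l)` with entry `(l,k)`, so the adjoint multiplier is the
transpose. -/
theorem trace_mul_schurMul (φ : n → n → ℂ) (A B : Matrix n n ℂ) :
    (A * schurMul U φ B).trace = (schurMul U (fun k l => φ l k) A * B).trace := by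
  rw [trace_mul_eq_trace_conj hU A, trace_mul_eq_trace_conj hU _ B]
  simp only [star_mul_schurMul_mul hU, trace, diag_apply, mul_apply, of_apply]
  refine Finset.sum_congr rfl fun k _ => Finset.sum_congr rfl fun l _ => ?_
  ring

theorem trace_conjDiag (d : n → ℂ) : (conjDiag U d).trace = ∑ k, d k := by
  rw [conjDiag, trace_mul_comm, ← Matrix.mul_assoc, mem_unitaryGroup_iff'.1 hU, Matrix.one_mul,
    trace_diagonal]

theorem exp_conjDiag (d : n → ℂ) :
    NormedSpace.exp (conjDiag U d) = conjDiag U (fun k => Complex.exp (d k)) := by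
  have h1 := mem_unitaryGroup_iff.1 hU
  have hinv : U⁻¹ = star U := Matrix.inv_eq_right_inv h1
  have hunit : IsUnit U := IsUnit.of_mul_eq_one _ h1
  rw [conjDiag, ← hinv, Matrix.exp_conj U _ hunit, Matrix.exp_diagonal, hinv, conjDiag]
  congr 3
  funext k
  rw [Pi.coe_exp, Complex.exp_eq_exp_ℂ]

omit hU in
theorem smul_conjDiag (z : ℂ) (d : n → ℂ) : z • conjDiag U d = conjDiag U (fun k => z * d k) := by
  have : diagonal (fun k => z * d k) = z • diagonal d := by
    rw [← diagonal_smul]; rfl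
  rw [conjDiag, conjDiag, this, Matrix.mul_smul, Matrix.smul_mul]

omit hU [DecidableEq n] in
theorem smul_schurMul (z : ℂ) (φ : n → n → ℂ) (Y : Matrix n n ℂ) :
    z • schurMul U φ Y = schurMul U (fun k l => z * φ k l) Y := by
  rw [schurMul, schurMul, ← Matrix.smul_mul, ← Matrix.mul_smul]
  congr 2
  ext k l
  simp [mul_assoc]

/-- Each entry is a finite combination of scalar integrals, so integrability of the multipliers
suffices to interchange integral and sums. -/
theorem matIntegral_conjDiag (g : ℝ → ℝ) (u v : ℝ → n → ℂ) (Y : Matrix n n ℂ)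
    (hint : ∀ k l, Integrable fun t => (g t : ℂ) * (u t k * v t l)) :
    (matIntegral fun t => (g t : ℂ) • (conjDiag U (u t) * Y * conjDiag U (v t))) =
      schurMul U (fun k l => ∫ t, (g t : ℂ) * (u t k * v t l)) Y := by
  ext a b
  have hentry : ∀ φ : n → n → ℂ, schurMul U φ Y a b =
      ∑ l, ∑ k, φ k l * (U a k * (star U * Y * U) k l * star U l b) := fun φ => by
    simp only [schurMul, mul_apply (M := U * _), mul_apply (M := U), of_apply, Finset.sum_mul]
    exact Finset.sum_congr rfl fun l _ => Finset.sum_congr rfl fun k _ => by ring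
  simp only [matIntegral, of_apply, conjDiag_mul_mul_conjDiag hU, smul_schurMul, hentry]
  rw [integral_finsetSum _ fun l _ => integrable_finsetSum _ fun k _ => (hint k l).mul_const _]
  refine Finset.sum_congr rfl fun l _ => ?_
  rw [integral_finsetSum _ fun k _ => (hint k l).mul_const _]
  exact Finset.sum_congr rfl fun k _ => integral_mul_const _ _

omit hU in
theorem exists_spectral {A : Matrix n n ℂ} (hA : A.IsHermitian) :
    ∃ U ∈ unitaryGroup n ℂ, A = conjDiag U (fun k => (hA.eigenvalues k : ℂ)) ∧
      ∀ f : ℝ → ℝ, cfc f A = conjDiag U (fun k => (f (hA.eigenvalues k) : ℂ)) := by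
  refine ⟨hA.eigenvectorUnitary, hA.eigenvectorUnitary.2, ?_, fun f => ?_⟩
  · conv_lhs => rw [hA.spectral_theorem]
    rfl
  · rw [hA.cfc_eq]
    rfl

end Spectral

end

section

open Matrix Finset

/-! ### Derivatives of power series in a noncommutative algebra -/

section PowerSeries

variable {𝔸 : Type*} [NormedRing 𝔸] [NormedAlgebra ℂ 𝔸] [NormOneClass 𝔸] [CompleteSpace 𝔸]

/-- On the ball of radius `r` the derivative of `B^n` has norm at most `n r^(n-1)`, so the series
may be differentiated term by term. -/
theorem hasFDerivAt_tsum_smul_pow {c : ℕ → ℂ} {r : ℝ}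
    (hc : Summable fun n => ‖c n‖ * (n * r ^ (n - 1))) {A : 𝔸} (hA : ‖A‖ < r) :
    ∃ L : 𝔸 →L[ℂ] 𝔸, HasFDerivAt (fun B => ∑' n, c n • B ^ n) L A ∧
      ∀ K, HasSum (fun n => c n • ∑ i ∈ range n, A ^ (n - 1 - i) * K * A ^ i) (L K) := by
  let T : ℕ → 𝔸 → 𝔸 →L[ℂ] 𝔸 := fun n B =>
    c n • ∑ i ∈ range n, ContinuousLinearMap.mulLeftRight ℂ 𝔸 (B ^ (n - 1 - i)) (B ^ i)
  have hT : ∀ n B, HasFDerivAt (fun B => c n • B ^ n) (T n B) B := fun n B => by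
    refine ((hasFDerivAt_pow' (𝕜 := ℂ) n (x := B)).const_smul (c n)).congr_fderiv ?_
    ext K
    simp [T, mul_assoc]
  have hbound : ∀ n B, B ∈ Metric.ball (0 : 𝔸) r → ‖T n B‖ ≤ ‖c n‖ * (n * r ^ (n - 1)) := by
    intro n B hB
    have hB' : ‖B‖ ≤ r := by simpa using (Metric.mem_ball.1 hB).le
    rw [norm_smul]
    gcongr
    refine (norm_sum_le _ _).trans ?_
    have : ∀ i ∈ range n, ‖ContinuousLinearMap.mulLeftRight ℂ 𝔸 (B ^ (n - 1 - i)) (B ^ i)‖ ≤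
        r ^ (n - 1) := fun i hi => by
      have hi' := mem_range.1 hi
      refine (ContinuousLinearMap.opNorm_mulLeftRight_apply_apply_le ℂ 𝔸 _ _).trans ?_
      calc ‖B ^ (n - 1 - i)‖ * ‖B ^ i‖ ≤ ‖B‖ ^ (n - 1 - i) * ‖B‖ ^ i := by
            gcongr <;> exact norm_pow_le _ _
        _ = ‖B‖ ^ (n - 1) := by rw [← pow_add]; congr 1; omega
        _ ≤ r ^ (n - 1) := by gcongr
    simpa using sum_le_sum this
  have h0 : (0 : 𝔸) ∈ Metric.ball (0 : 𝔸) r := by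
    simpa using (norm_nonneg A).trans_lt hA
  have hA' : A ∈ Metric.ball (0 : 𝔸) r := by simpa using hA
  refine ⟨∑' n, T n A, hasFDerivAt_tsum_of_isPreconnected hc Metric.isOpen_ball
    (convex_ball (0 : 𝔸) r).isPreconnected (fun n x _ => hT n x) hbound h0 ?_ hA', fun K => ?_⟩
  · refine summable_of_ne_finset_zero (s := {0}) fun n hn => ?_
    simp [zero_pow (by simpa using hn : n ≠ 0)]
  · have hs : Summable fun n => T n A := .of_norm_bounded hc fun n => hbound n A hA'
    refine ((ContinuousLinearMap.apply ℂ 𝔸 K).hasSum hs.hasSum).congr_fun fun n => ?_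
    simp [T]

/-- The divided difference of the power series with coefficients `c`. -/
noncomputable def powDivDiff (c : ℕ → ℂ) (x y : ℂ) : ℂ :=
  ∑' n, c n * ∑ i ∈ range n, x ^ (n - 1 - i) * y ^ i

theorem hasSum_powDivDiff {c : ℕ → ℂ} {r : ℝ}
    (hc : Summable fun n => ‖c n‖ * (n * r ^ (n - 1))) {x y : ℂ} (hx : ‖x‖ < r) (hy : ‖y‖ < r) :
    HasSum (fun n => c n * ∑ i ∈ range n, x ^ (n - 1 - i) * y ^ i) (powDivDiff c x y) := by
  refine (Summable.of_norm_bounded hc fun n => ?_).hasSum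
  rw [norm_mul]
  gcongr
  refine (norm_sum_le _ _).trans ?_
  have : ∀ i ∈ range n, ‖x ^ (n - 1 - i) * y ^ i‖ ≤ r ^ (n - 1) := fun i hi => by
    have hi' := mem_range.1 hi
    have hr : 0 ≤ r := (norm_nonneg x).trans hx.le
    rw [norm_mul, norm_pow, norm_pow]
    calc ‖x‖ ^ (n - 1 - i) * ‖y‖ ^ i ≤ r ^ (n - 1 - i) * r ^ i := by gcongr
      _ = r ^ (n - 1) := by rw [← pow_add]; congr 1; omega
  simpa using sum_le_sum this

theorem powDivDiff_mul_sub {c : ℕ → ℂ} {r : ℝ}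
    (hc : Summable fun n => ‖c n‖ * (n * r ^ (n - 1))) {x y fx fy : ℂ} (hx : ‖x‖ < r)
    (hy : ‖y‖ < r) (hfx : HasSum (fun n => c n * x ^ n) fx)
    (hfy : HasSum (fun n => c n * y ^ n) fy) :
    powDivDiff c x y * (x - y) = fx - fy := by
  refine ((hasSum_powDivDiff hc hx hy).mul_right (x - y)).unique
    ((hfx.sub hfy).congr_fun fun n => ?_)
  have h := geom_sum₂_mul y x n
  rw [← mul_sub, mul_assoc]
  congr 1
  have e : ∑ i ∈ range n, x ^ (n - 1 - i) * y ^ i = ∑ i ∈ range n, y ^ i * x ^ (n - 1 - i) :=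
    sum_congr rfl fun i _ => mul_comm _ _
  rw [e]
  linear_combination -h

/-- The case `𝔸 = ℂ`, `K = 1` of the noncommutative derivative. -/
theorem powDivDiff_self {c : ℕ → ℂ} {r : ℝ}
    (hc : Summable fun n => ‖c n‖ * (n * r ^ (n - 1))) {x d : ℂ} (hx : ‖x‖ < r)
    (hd : HasDerivAt (fun z => ∑' n, c n * z ^ n) d x) : powDivDiff c x x = d := by
  obtain ⟨L, hL, hLs⟩ := hasFDerivAt_tsum_smul_pow hc hx
  have h1 := hL.hasDerivAt.unique hd
  have h2 := hLs 1
  simp only [mul_one, smul_eq_mul] at h2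
  rw [← h1, ← h2.unique (hasSum_powDivDiff hc hx hx)]

end PowerSeries

/-! ### Power series of matrices: the Daleckii–Krein formula -/

section MatrixPowerSeries

open scoped Matrix.Norms.L2Operator

variable {n : Type*} [Fintype n] [DecidableEq n]

/-- With the operator norm, convergence of a power series becomes a condition on the eigenvalues
alone. -/
theorem norm_conjDiag {U : Matrix n n ℂ} (hU : U ∈ unitaryGroup n ℂ) (d : n → ℂ) :
    ‖conjDiag U d‖ = ‖d‖ := by
  have h : star U ∈ unitary (Matrix n n ℂ) := Unitary.star_mem hU
  rw [conjDiag, CStarRing.norm_mul_mem_unitary _ h, CStarRing.norm_mem_unitary_mul _ hU,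
    l2_opNorm_diagonal]

theorem hasSum_conjDiag (U : Matrix n n ℂ) {d : ℕ → n → ℂ} {D : n → ℂ}
    (h : ∀ k, HasSum (fun m => d m k) (D k)) :
    HasSum (fun m => conjDiag U (d m)) (conjDiag U D) :=
  ((Pi.hasSum.2 h).matrix_diagonal.mul_left U).mul_right (star U)

omit [DecidableEq n] in
theorem hasSum_schurMul (U K : Matrix n n ℂ) {φ : ℕ → n → n → ℂ} {Φ : n → n → ℂ}
    (h : ∀ k l, HasSum (fun m => φ m k l) (Φ k l)) :
    HasSum (fun m => schurMul U (φ m) K) (schurMul U Φ K) := by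
  have : HasSum (fun m => (Matrix.of fun k l => φ m k l * (star U * K * U) k l : Matrix n n ℂ))
      (Matrix.of fun k l => Φ k l * (star U * K * U) k l) :=
    Pi.hasSum.2 fun k => Pi.hasSum.2 fun l => (h k l).mul_right _
  exact (this.mul_left U).mul_right (star U)

omit [DecidableEq n] in
theorem sum_schurMul (U K : Matrix n n ℂ) {ι : Type*} (s : Finset ι) (φ : ι → n → n → ℂ) :
    ∑ i ∈ s, schurMul U (φ i) K = schurMul U (fun k l => ∑ i ∈ s, φ i k l) K := by
  simp only [schurMul]
  rw [← Finset.sum_mul, ← Finset.mul_sum]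
  congr 2
  ext k l
  simp [Matrix.sum_apply, Finset.sum_mul]

theorem conjDiag_pow {U : Matrix n n ℂ} (hU : U ∈ unitaryGroup n ℂ) (d : n → ℂ) (m : ℕ) :
    conjDiag U d ^ m = conjDiag U (fun k => d k ^ m) := by
  induction m with
  | zero =>
    simp only [pow_zero]
    rw [conjDiag, show (diagonal fun _ => 1 : Matrix n n ℂ) = 1 from diagonal_one, Matrix.mul_one,
      mem_unitaryGroup_iff.1 hU]
  | succ m ih =>
    refine conj_injective hU ?_
    rw [pow_succ, star_mul_mul_mul hU, ih]
    simp only [star_mul_conjDiag_mul hU, diagonal_mul_diagonal, pow_succ]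

/-- In the eigenbasis, `K ↦ A^p K A^q` multiplies entry `(k,l)` by `d_k^p d_l^q`; summing these
gives the divided difference. -/
theorem hasFDerivAt_tsum_smul_pow_conjDiag [Nonempty n] {c : ℕ → ℂ} {r : ℝ}
    (hc : Summable fun n => ‖c n‖ * (n * r ^ (n - 1))) {U : Matrix n n ℂ}
    (hU : U ∈ unitaryGroup n ℂ) {d : n → ℂ} (hd : ∀ k, ‖d k‖ < r) :
    ∃ L : Matrix n n ℂ →L[ℂ] Matrix n n ℂ,
      HasFDerivAt (fun B : Matrix n n ℂ => ∑' m, c m • B ^ m) L (conjDiag U d) ∧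
      ∀ K, L K = schurMul U (fun k l => powDivDiff c (d k) (d l)) K := by
  have hr : 0 < r := (norm_nonneg _).trans_lt (hd (Classical.arbitrary n))
  obtain ⟨L, hL, hLs⟩ := hasFDerivAt_tsum_smul_pow hc (A := conjDiag U d)
    (by rw [norm_conjDiag hU, pi_norm_lt_iff hr]; exact hd)
  refine ⟨L, hL, fun K => (hLs K).unique ?_⟩
  refine (hasSum_schurMul U K fun k l => hasSum_powDivDiff hc (hd k) (hd l)).congr_fun fun m => ?_
  simp only [conjDiag_pow hU, conjDiag_mul_mul_conjDiag hU, sum_schurMul, smul_schurMul]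

end MatrixPowerSeries

end

section

open Matrix Finset Filter Topology MeasureTheory

/-! ### Derivatives of the matrix exponential and logarithm -/

/-- The Fourier transform of the high-peak tent density. -/
noncomputable def tentFourier (w : ℝ) : ℂ :=
  ∫ t : ℝ, (tentDensity t : ℂ) * Complex.exp (Complex.I * w * t)

/-- The Fourier transform of the logistic density. -/
noncomputable def logisticFourier (w : ℝ) : ℂ :=
  ∫ t : ℝ, (logisticDensity t : ℂ) * Complex.exp (Complex.I * w * t)

theorem tentFourier_zero : tentFourier 0 = 1 := by
  simpa [tentFourier] using integral_tentDensity

theorem logisticFourier_zero : logisticFourier 0 = 1 := by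
  simpa [logisticFourier] using integral_logisticDensity

theorem summable_exp_coeff (r : ℝ) :
    Summable fun n : ℕ => ‖((n.factorial : ℂ))⁻¹‖ * (n * r ^ (n - 1)) := by
  rw [← summable_nat_add_iff 1]
  refine (Real.summable_pow_div_factorial r).congr fun n => ?_
  have h : (n.factorial : ℝ) ≠ 0 := by exact_mod_cast n.factorial_ne_zero
  have h2 : (n + 1 : ℝ) ≠ 0 := by positivity
  rw [norm_inv, Complex.norm_natCast, Nat.factorial_succ]
  push_cast
  field_simp

theorem hasSum_exp_coeff (z : ℂ) :
    HasSum (fun n : ℕ => ((n.factorial : ℂ))⁻¹ * z ^ n) (Complex.exp z) := by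
  have h := NormedSpace.exp_series_hasSum_exp' (𝕂 := ℂ) z
  rw [← Complex.exp_eq_exp_ℂ] at h
  simpa using h

theorem powDivDiff_exp (x y : ℝ) :
    powDivDiff (fun n => ((n.factorial : ℂ))⁻¹) x y =
      1 / 2 * (Complex.exp x + Complex.exp y) * tentFourier (x - y) := by
  set r := ‖(x : ℂ)‖ + ‖(y : ℂ)‖ + 1
  have hx : ‖(x : ℂ)‖ < r := by have := norm_nonneg (y : ℂ); simp only [r]; linarith
  have hy : ‖(y : ℂ)‖ < r := by have := norm_nonneg (x : ℂ); simp only [r]; linarith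
  rcases eq_or_ne x y with rfl | hxy
  · rw [sub_self, tentFourier_zero, powDivDiff_self (summable_exp_coeff r) hx
      (d := Complex.exp x)]
    · ring
    · have : (fun z : ℂ => ∑' n : ℕ, ((n.factorial : ℂ))⁻¹ * z ^ n) = Complex.exp :=
        funext fun z => (hasSum_exp_coeff z).tsum_eq
      rw [this]
      exact Complex.hasDerivAt_exp _
  · have hsub : (x : ℂ) - y ≠ 0 := sub_ne_zero.2 (by exact_mod_cast hxy)
    refine mul_right_cancel₀ hsub ?_
    rw [powDivDiff_mul_sub (summable_exp_coeff r) hx hy (hasSum_exp_coeff x) (hasSum_exp_coeff y)]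
    have h := integral_tentDensity_mul_exp (x - y)
    rw [← tentFourier] at h
    have e : Complex.exp y = Complex.exp x * Complex.exp (-((x - y : ℝ) : ℂ)) := by
      rw [← Complex.exp_add]; congr 1; push_cast; ring
    rw [e]
    push_cast at h ⊢
    linear_combination (-1 / 2 * Complex.exp x) * h

theorem summable_log_coeff {r : ℝ} (h0 : 0 ≤ r) (h1 : r < 1) :
    Summable fun n : ℕ => ‖(-(n : ℂ)⁻¹)‖ * (n * r ^ (n - 1)) := by
  rw [← summable_nat_add_iff 1]
  refine (summable_geometric_of_lt_one h0 h1).congr fun n => ?_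
  have h2 : (n + 1 : ℝ) ≠ 0 := by positivity
  rw [norm_neg, norm_inv, Complex.norm_natCast, Nat.add_sub_cancel]
  push_cast
  field_simp

/-- The coefficient at `n = 0` vanishes since `0⁻¹ = 0`. -/
theorem hasSum_log_coeff {z : ℂ} (hz : ‖z‖ < 1) :
    HasSum (fun n : ℕ => (-(n : ℂ)⁻¹) * z ^ n) (Complex.log (1 - z)) := by
  have h := (Complex.hasSum_taylorSeries_neg_log hz).neg
  rw [neg_neg] at h
  refine h.congr_fun fun n => ?_
  ring

/-- The minus sign comes from expanding `log (1 - z)` in `z = 1 - x`. For `x = e^a`, `y = e^b`, the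
factor `e^{-(a+b)/2}` turns `y - x` into `2 sinh ((b - a)/2)`. -/
theorem powDivDiff_log {r x y : ℝ} (hr1 : r < 1) (hx0 : 0 < x) (hy0 : 0 < y)
    (hx : |1 - x| < r) (hy : |1 - y| < r) :
    powDivDiff (fun n => -(n : ℂ)⁻¹) (1 - x) (1 - y) =
      -(Complex.exp (-(1 / 2) * Real.log x) * Complex.exp (-(1 / 2) * Real.log y) *
        logisticFourier ((Real.log y - Real.log x) / 2)) := by
  have hr0 : 0 ≤ r := (abs_nonneg _).trans hx.le
  have hx' : ‖(1 - x : ℂ)‖ < r := by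
    rw [← Complex.ofReal_one, ← Complex.ofReal_sub, Complex.norm_real]; exact hx
  have hy' : ‖(1 - y : ℂ)‖ < r := by
    rw [← Complex.ofReal_one, ← Complex.ofReal_sub, Complex.norm_real]; exact hy
  rcases eq_or_ne x y with rfl | hxy
  · rw [sub_self, zero_div, logisticFourier_zero, powDivDiff_self (summable_log_coeff hr0 hr1) hx'
      (d := -(x : ℂ)⁻¹)]
    · rw [← Complex.exp_add]
      have : (-(1 / 2) * (Real.log x : ℂ) + -(1 / 2) * (Real.log x : ℂ)) =
        ((-Real.log x : ℝ) : ℂ) := by push_cast; ring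
      rw [this, ← Complex.ofReal_exp, Real.exp_neg, Real.exp_log hx0]
      push_cast
      ring
    · have h1 : HasDerivAt (fun z : ℂ => Complex.log (1 - z)) (-(x : ℂ)⁻¹) (1 - x) := by
        have h := ((hasDerivAt_id (1 - x : ℂ)).const_sub 1).clog (by simp [Complex.slitPlane, hx0])
        refine h.congr_deriv ?_
        simp [div_eq_mul_inv]
      refine h1.congr_of_eventuallyEq ?_
      filter_upwards [(continuous_norm.tendsto (1 - x : ℂ)).eventually
        (gt_mem_nhds (hx'.trans hr1))] with z hz
      exact (hasSum_log_coeff hz).tsum_eq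
  · have hsub : (1 - x : ℂ) - (1 - y) ≠ 0 := by
      rw [sub_sub_sub_cancel_left]
      exact sub_ne_zero.2 (by exact_mod_cast hxy.symm)
    refine mul_right_cancel₀ hsub ?_
    rw [powDivDiff_mul_sub (summable_log_coeff hr0 hr1) hx' hy'
      (hasSum_log_coeff (hx'.trans hr1)) (hasSum_log_coeff (hy'.trans hr1)), sub_sub_cancel,
      sub_sub_cancel, sub_sub_sub_cancel_left, ← Complex.ofReal_log hx0.le,
      ← Complex.ofReal_log hy0.le]
    obtain ⟨a, rfl⟩ : ∃ a, x = Real.exp a := ⟨_, (Real.exp_log hx0).symm⟩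
    obtain ⟨b, rfl⟩ : ∃ b, y = Real.exp b := ⟨_, (Real.exp_log hy0).symm⟩
    rw [Real.log_exp, Real.log_exp]
    have h := integral_logisticDensity_mul_exp ((b - a) / 2)
    rw [← logisticFourier, Complex.ofReal_sinh, Complex.sinh] at h
    have e : Complex.exp (-(1 / 2) * a) * Complex.exp (-(1 / 2) * b) *
        ((Real.exp b : ℂ) - Real.exp a) = Complex.exp (((b - a) / 2 : ℝ) : ℂ) -
          Complex.exp (-(((b - a) / 2 : ℝ) : ℂ)) := by
      rw [Complex.ofReal_exp, Complex.ofReal_exp, mul_sub, ← Complex.exp_add, ← Complex.exp_add,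
        ← Complex.exp_add]
      push_cast
      ring_nf
    push_cast at e h ⊢
    linear_combination logisticFourier ((b - a) / 2) * e + 2 * h

section MatrixFunctions

open scoped Matrix.Norms.L2Operator

variable {n : Type*} [Fintype n] [DecidableEq n] [Nonempty n]

theorem hasFDerivAt_exp_conjDiag {U : Matrix n n ℂ} (hU : U ∈ unitaryGroup n ℂ) (a : n → ℝ) :
    ∃ L : Matrix n n ℂ →L[ℂ] Matrix n n ℂ,
      HasFDerivAt (NormedSpace.exp : Matrix n n ℂ → Matrix n n ℂ) L
        (conjDiag U fun k => (a k : ℂ)) ∧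
      ∀ K, L K = schurMul U (fun k l =>
        1 / 2 * (Complex.exp (a k) + Complex.exp (a l)) * tentFourier (a k - a l)) K := by
  obtain ⟨L, hL, hLs⟩ := hasFDerivAt_tsum_smul_pow_conjDiag
    (summable_exp_coeff (‖fun k => (a k : ℂ)‖ + 1)) hU (d := fun k => (a k : ℂ))
    (fun k => (norm_le_pi_norm (fun k => (a k : ℂ)) k).trans_lt (lt_add_one _))
  refine ⟨L, ?_, fun K => ?_⟩
  · rw [NormedSpace.exp_eq_tsum ℂ]
    exact hL
  · simp only [hLs, powDivDiff_exp]

omit [Nonempty n] in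
theorem one_sub_conjDiag {U : Matrix n n ℂ} (hU : U ∈ unitaryGroup n ℂ) (d : n → ℂ) :
    1 - conjDiag U d = conjDiag U (fun k => 1 - d k) := by
  refine conj_injective hU ?_
  rw [star_mul_conjDiag_mul hU, Matrix.mul_sub, Matrix.sub_mul, Matrix.mul_one,
    mem_unitaryGroup_iff'.1 hU, star_mul_conjDiag_mul hU, ← diagonal_one, diagonal_sub]

omit [Nonempty n] in
theorem matLog_eq_tsum {B : Matrix n n ℂ} (hB : B.IsHermitian) (hB1 : ‖1 - B‖ < 1) :
    matLog B = ∑' m : ℕ, (-(m : ℂ)⁻¹) • (1 - B) ^ m := by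
  obtain ⟨U, hU, hBU, hf⟩ := exists_spectral hB
  have h1 : 1 - B = conjDiag U (fun k => 1 - (hB.eigenvalues k : ℂ)) := by
    conv_lhs => rw [hBU, one_sub_conjDiag hU]
  rw [h1, norm_conjDiag hU, pi_norm_lt_iff one_pos] at hB1
  rw [matLog, hf, h1]
  refine (HasSum.tsum_eq ?_).symm
  simp only [conjDiag_pow hU, smul_conjDiag]
  refine hasSum_conjDiag U fun k => ?_
  have hk := hB1 k
  have h2 := hasSum_log_coeff hk
  rw [sub_sub_cancel] at h2
  rw [← Complex.ofReal_one, ← Complex.ofReal_sub, Complex.norm_real, Real.norm_eq_abs] at hk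
  rwa [Complex.ofReal_log (by linarith [(abs_lt.1 hk).2])]

/-- Eigenvalues in `(0, 1]` put `S s₀` strictly inside `‖1 - B‖ < 1`, where the functional calculus
agrees with the logarithmic series. By continuity nearby `S s` lie there too. -/
theorem hasDerivAt_matLog {S : ℝ → Matrix n n ℂ} {s₀ : ℝ} {Δ : Matrix n n ℂ}
    (hS : ∀ s, (S s).IsHermitian) (hd : HasDerivAt S Δ s₀) {U : Matrix n n ℂ}
    (hU : U ∈ unitaryGroup n ℂ) {a : n → ℝ} (ha : S s₀ = conjDiag U fun k => (a k : ℂ))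
    (ha0 : ∀ k, 0 < a k) (ha1 : ∀ k, a k ≤ 1) :
    HasDerivAt (fun s => matLog (S s)) (schurMul U (fun k l =>
      Complex.exp (-(1 / 2) * Real.log (a k)) * Complex.exp (-(1 / 2) * Real.log (a l)) *
        logisticFourier ((Real.log (a l) - Real.log (a k)) / 2)) Δ) s₀ := by
  have habs : ∀ k, ‖(1 - a k : ℂ)‖ < 1 := fun k => by
    rw [← Complex.ofReal_one, ← Complex.ofReal_sub, Complex.norm_real, Real.norm_eq_abs, abs_lt]
    constructor <;> linarith [ha0 k, ha1 k]
  obtain ⟨r, hr, hr1⟩ := exists_between ((pi_norm_lt_iff one_pos).2 habs)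
  have hr' : ∀ k, ‖(1 - a k : ℂ)‖ < r := fun k => (norm_le_pi_norm _ k).trans_lt hr
  have hr0 : 0 ≤ r := (norm_nonneg _).trans hr.le
  have hr'' : ∀ k, |1 - a k| < r := fun k => by
    have := hr' k
    rwa [← Complex.ofReal_one, ← Complex.ofReal_sub, Complex.norm_real, Real.norm_eq_abs] at this
  obtain ⟨L, hL, hLs⟩ := hasFDerivAt_tsum_smul_pow_conjDiag (summable_log_coeff hr0 hr1) hU hr'
  have h1 : 1 - S s₀ = conjDiag U fun k => 1 - (a k : ℂ) := by rw [ha, one_sub_conjDiag hU]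
  rw [← h1] at hL
  have hcomp := (hL.restrictScalars ℝ).comp_hasDerivAt s₀ (hd.const_sub 1)
  refine (hcomp.congr_of_eventuallyEq ?_).congr_deriv ?_
  · have hlt : ‖1 - S s₀‖ < 1 := by
      rw [h1, norm_conjDiag hU, pi_norm_lt_iff one_pos]
      exact habs
    filter_upwards [(hd.const_sub 1).continuousAt.norm.eventually (gt_mem_nhds hlt)] with s hs
    exact matLog_eq_tsum (hS s) hs
  · have hk : ∀ k l, powDivDiff (fun n => -(n : ℂ)⁻¹) (1 - (a k : ℂ)) (1 - (a l : ℂ)) = -1 *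
        (Complex.exp (-(1 / 2) * Real.log (a k)) * Complex.exp (-(1 / 2) * Real.log (a l)) *
          logisticFourier ((Real.log (a l) - Real.log (a k)) / 2)) := fun k l => by
      rw [powDivDiff_log hr1 (ha0 k) (ha0 l) (hr'' k) (hr'' l), neg_one_mul]
    change L (-Δ) = _
    rw [map_neg, hLs]
    simp only [hk, ← smul_schurMul]
    simp

end MatrixFunctions

end

section

open Matrix Finset

/-! ### Quantum–classical Hamiltonians -/

section Hidden

variable {V H X : Type*} [Fintype H] [DecidableEq H] [Fintype X]

omit [DecidableEq H] in
theorem inner_eq_sum_star_mul (φ ψ : EuclideanSpace ℂ H) : inner ℂ φ ψ = ∑ h, star (φ h) * ψ h := by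
  rw [PiLp.inner_apply]
  exact sum_congr rfl fun h _ => by simp [mul_comm]

omit [DecidableEq H] in
theorem ketbra_mul_ketbra (φ ψ : EuclideanSpace ℂ H) :
    ketbra φ * ketbra ψ = inner ℂ φ ψ • Matrix.of fun k l => φ k * star (ψ l) := by
  ext k l
  rw [inner_eq_sum_star_mul, Matrix.smul_apply, smul_eq_mul, mul_apply, sum_mul]
  refine sum_congr rfl fun h _ => ?_
  simp only [ketbra, of_apply]
  ring

omit [DecidableEq H] in
theorem trace_ketbra (ψ : EuclideanSpace ℂ H) : (ketbra ψ).trace = inner ℂ ψ ψ := by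
  rw [inner_eq_sum_star_mul]
  exact sum_congr rfl fun h _ => mul_comm _ _

theorem sum_ketbra (e : OrthonormalBasis X ℂ (EuclideanSpace ℂ H)) : ∑ x, ketbra (e x) = 1 := by
  ext k l
  have h := congrArg (fun v : EuclideanSpace ℂ H => v k) (e.sum_repr' (EuclideanSpace.single l 1))
  simp only [inner_eq_sum_star_mul] at h
  simp at h
  rw [Matrix.sum_apply, one_apply, ← h]
  exact sum_congr rfl fun x _ => by simp [ketbra, mul_comm]

variable [Fintype V] [DecidableEq V]

/-- Block-diagonal operators with respect to an orthonormal basis of the hidden space. -/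
noncomputable def blockHom (e : OrthonormalBasis X ℂ (EuclideanSpace ℂ H)) :
    (X → Matrix V V ℂ) →+* Matrix (V × H) (V × H) ℂ where
  toFun M := ∑ x, M x ⊗ₖ ketbra (e x)
  map_one' := by
    classical
    have h : (∑ x, (1 : Matrix V V ℂ) ⊗ₖ ketbra (e x)) = 1 ⊗ₖ ∑ x, ketbra (e x) := by
      ext i j
      simp only [Matrix.sum_apply, kroneckerMap_apply, mul_sum]
    simp only [Pi.one_apply]
    rw [h, sum_ketbra, one_kronecker_one]
  map_mul' M N := by
    classical
    rw [sum_mul]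
    refine sum_congr rfl fun x _ => ?_
    rw [mul_sum, sum_eq_single x]
    · rw [← mul_kronecker_mul, ketbra_mul_ketbra, orthonormal_iff_ite.1 e.orthonormal, if_pos rfl,
        one_smul]
      rfl
    · intro y _ hy
      rw [← mul_kronecker_mul, ketbra_mul_ketbra, orthonormal_iff_ite.1 e.orthonormal,
        if_neg hy.symm, zero_smul, kronecker_zero]
    · simp
  map_zero' := by simp
  map_add' M N := by simp [add_kronecker, sum_add_distrib]

theorem blockHom_apply (e : OrthonormalBasis X ℂ (EuclideanSpace ℂ H)) (M : X → Matrix V V ℂ) :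
    blockHom e M = ∑ x, M x ⊗ₖ ketbra (e x) := rfl

theorem continuous_blockHom (e : OrthonormalBasis X ℂ (EuclideanSpace ℂ H)) :
    Continuous (blockHom e : (X → Matrix V V ℂ) → Matrix (V × H) (V × H) ℂ) := by
  refine continuous_matrix fun i j => ?_
  simp only [blockHom_apply, Matrix.sum_apply, kroneckerMap_apply]
  fun_prop

section
open scoped Matrix.Norms.L2Operator

/-- A continuous ring homomorphism commutes with `exp`, and `exp` on a product algebra is
componentwise. -/
theorem exp_blockHom (e : OrthonormalBasis X ℂ (EuclideanSpace ℂ H)) (M : X → Matrix V V ℂ) :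
    NormedSpace.exp (blockHom e M) = blockHom e fun x => NormedSpace.exp (M x) := by
  let _ : NormedAlgebra ℚ (Matrix V V ℂ) := .restrictScalars ℚ ℂ _
  rw [← NormedSpace.map_exp (blockHom (V := V) e) (continuous_blockHom e) M]
  congr 1
  funext x
  rw [Pi.coe_exp]

end

theorem trace_blockHom (e : OrthonormalBasis X ℂ (EuclideanSpace ℂ H)) (M : X → Matrix V V ℂ) :
    (blockHom e M).trace = ∑ x, (M x).trace := by
  rw [blockHom_apply, trace_sum]
  refine sum_congr rfl fun x _ => ?_
  rw [trace_kronecker, trace_ketbra, e.inner_eq_one, mul_one]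

theorem partialTraceRight_blockHom (e : OrthonormalBasis X ℂ (EuclideanSpace ℂ H))
    (M : X → Matrix V V ℂ) : partialTraceRight (blockHom e M) = ∑ x, M x := by
  ext a b
  simp only [partialTraceRight, of_apply, blockHom_apply, Matrix.sum_apply, kroneckerMap_apply]
  rw [sum_comm]
  refine sum_congr rfl fun x _ => ?_
  have h := trace_ketbra (e x)
  rw [e.inner_eq_one] at h
  rw [← mul_sum, show ∑ h, ketbra (e x) h h = 1 from h, mul_one]

variable {J : ℕ} (e : OrthonormalBasis X ℂ (EuclideanSpace ℂ H)) (Gv : Fin J → X → Matrix V V ℂ)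
  (θ : Fin J → ℝ)

theorem hamiltonian_eq_blockHom :
    hamiltonian e Gv θ = blockHom e fun x => visHamiltonian Gv θ x := by
  simp only [hamiltonian, hamTerm, blockHom_apply, visHamiltonian]
  ext i j
  simp only [Matrix.sum_apply, Matrix.smul_apply, kroneckerMap_apply, smul_eq_mul, sum_mul, mul_sum]
  rw [sum_comm]
  exact sum_congr rfl fun x _ => sum_congr rfl fun j _ => by ring

theorem exp_neg_hamiltonian :
    NormedSpace.exp (-hamiltonian e Gv θ) =
      blockHom e fun x => NormedSpace.exp (-visHamiltonian Gv θ x) := by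
  rw [hamiltonian_eq_blockHom, ← map_neg, exp_blockHom]
  rfl

/-- The unnormalised reduced state `∑ x, exp (-G_v^x(θ))`. -/
noncomputable def gibbsSum : Matrix V V ℂ := ∑ x, NormedSpace.exp (-visHamiltonian Gv θ x)

theorem sigmaV_eq : sigmaV e Gv θ = (gibbsSum Gv θ).trace⁻¹ • gibbsSum Gv θ := by
  rw [sigmaV, sigmaVH, thermalState, exp_neg_hamiltonian, trace_blockHom, gibbsSum, trace_sum,
    ← partialTraceRight_blockHom e]
  ext a b
  simp [partialTraceRight, mul_sum]

theorem prob_eq (x : X) : prob e Gv θ x =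
    (NormedSpace.exp (-visHamiltonian Gv θ x)).trace.re / (gibbsSum Gv θ).trace.re := by
  rw [prob, exp_neg_hamiltonian, trace_blockHom, gibbsSum, trace_sum]

end Hidden

/-! ### Positivity and normalisation of the Gibbs states -/

section Positivity

variable {V : Type*} [Fintype V] [DecidableEq V]

theorem posDef_exp {A : Matrix V V ℂ} (hA : A.IsHermitian) : (NormedSpace.exp A).PosDef := by
  obtain ⟨U, hU, hAU, -⟩ := exists_spectral hA
  have hunit : IsUnit U := IsUnit.of_mul_eq_one _ (mem_unitaryGroup_iff.1 hU)
  rw [hAU, exp_conjDiag hU, conjDiag, IsUnit.posDef_star_right_conjugate_iff hunit]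
  refine PosDef.diagonal fun k => ?_
  rw [← Complex.ofReal_exp]
  exact_mod_cast Real.exp_pos _

omit [DecidableEq V] in
theorem PosDef.trace_eq_ofReal [Nonempty V] {A : Matrix V V ℂ} (hA : A.PosDef) :
    0 < A.trace.re ∧ (A.trace.re : ℂ) = A.trace := by
  have h := Complex.pos_iff.1 hA.trace_pos
  exact ⟨h.1, Complex.ext rfl h.2⟩

variable {X : Type*} [Fintype X] {J : ℕ} {Gv : Fin J → X → Matrix V V ℂ}

omit [Fintype V] [DecidableEq V] [Fintype X] in
theorem isHermitian_visHamiltonian (hGv : ∀ j x, (Gv j x).IsHermitian) (θ : Fin J → ℝ) (x : X) :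
    (visHamiltonian Gv θ x).IsHermitian := by
  unfold visHamiltonian
  refine isSelfAdjoint_sum _ fun j _ => ?_
  exact IsSelfAdjoint.smul (r := (θ j : ℂ)) (Complex.conj_ofReal _) (hGv j x).isSelfAdjoint

theorem posDef_gibbsSum [Nonempty X] (hGv : ∀ j x, (Gv j x).IsHermitian) (θ : Fin J → ℝ) :
    (gibbsSum Gv θ).PosDef :=
  sum_induction_nonempty _ Matrix.PosDef (fun _ _ => Matrix.PosDef.add) univ_nonempty fun x _ =>
    posDef_exp (isHermitian_visHamiltonian hGv θ x).neg

variable {H : Type*} [Fintype H] [DecidableEq H] (e : OrthonormalBasis X ℂ (EuclideanSpace ℂ H))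

theorem prob_smul_sigmaVx [Nonempty V] [Nonempty X] (hGv : ∀ j x, (Gv j x).IsHermitian)
    (θ : Fin J → ℝ) (x : X) : (prob e Gv θ x : ℂ) • sigmaVx Gv θ x =
      (gibbsSum Gv θ).trace⁻¹ • NormedSpace.exp (-visHamiltonian Gv θ x) := by
  have h1 := PosDef.trace_eq_ofReal (posDef_exp (isHermitian_visHamiltonian hGv θ x).neg)
  have h2 := PosDef.trace_eq_ofReal (posDef_gibbsSum hGv θ)
  have h3 : (NormedSpace.exp (-visHamiltonian Gv θ x)).trace ≠ 0 := by
    rw [← h1.2]; exact_mod_cast h1.1.ne'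
  rw [prob_eq, sigmaVx, thermalState, smul_smul]
  congr 1
  push_cast
  rw [h1.2, h2.2]
  field_simp

theorem posDef_sigmaV [Nonempty V] [Nonempty X] (hGv : ∀ j x, (Gv j x).IsHermitian)
    (θ : Fin J → ℝ) : (sigmaV e Gv θ).PosDef := by
  have h2 := PosDef.trace_eq_ofReal (posDef_gibbsSum hGv θ)
  rw [sigmaV_eq, ← h2.2, ← Complex.ofReal_inv]
  exact (posDef_gibbsSum hGv θ).smul (by exact_mod_cast inv_pos.2 h2.1)

theorem trace_sigmaV [Nonempty V] [Nonempty X] (hGv : ∀ j x, (Gv j x).IsHermitian)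
    (θ : Fin J → ℝ) : (sigmaV e Gv θ).trace = 1 := by
  have h2 := PosDef.trace_eq_ofReal (posDef_gibbsSum hGv θ)
  have h3 : (gibbsSum Gv θ).trace ≠ 0 := by
    rw [← h2.2]; exact_mod_cast h2.1.ne'
  rw [sigmaV_eq, trace_smul, smul_eq_mul, inv_mul_cancel₀ h3]

theorem sigmaV_eq_sum_prob_smul [Nonempty V] [Nonempty X] (hGv : ∀ j x, (Gv j x).IsHermitian)
    (θ : Fin J → ℝ) : sigmaV e Gv θ = ∑ x, prob e Gv θ x • sigmaVx Gv θ x := by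
  rw [sigmaV_eq]
  conv_lhs => arg 2; rw [gibbsSum]
  rw [smul_sum]
  refine sum_congr rfl fun x _ => ?_
  rw [← prob_smul_sigmaVx e hGv]
  rfl

end Positivity

end

section

open Matrix Finset MeasureTheory

/-! ### The quantum channels in an eigenbasis -/

section Channels

theorem fourier_neg {f : ℝ → ℝ} (hf : ∀ t, f (-t) = f t) (w : ℝ) :
    ∫ t : ℝ, (f t : ℂ) * Complex.exp (Complex.I * (-w : ℝ) * t) =
      ∫ t : ℝ, (f t : ℂ) * Complex.exp (Complex.I * w * t) := by
  rw [← integral_neg_eq_self]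
  congr 1 with t
  rw [hf]
  push_cast
  ring_nf

theorem tentFourier_neg (w : ℝ) : tentFourier (-w) = tentFourier w :=
  fourier_neg (fun t => by
    simp only [tentDensity, mul_neg, neg_div, Real.cosh_neg, Real.sinh_neg, div_neg, abs_neg]) w

theorem logisticFourier_neg (w : ℝ) : logisticFourier (-w) = logisticFourier w :=
  fourier_neg (fun t => by simp only [logisticDensity, mul_neg, Real.cosh_neg]) w

variable {V H X : Type*} [Fintype V] [DecidableEq V] [Fintype H] [DecidableEq H] [Fintype X]
  {J : ℕ} (e : OrthonormalBasis X ℂ (EuclideanSpace ℂ H)) {Gv : Fin J → X → Matrix V V ℂ}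
  {θ : Fin J → ℝ} {x : X} {U : Matrix V V ℂ} (hU : U ∈ unitaryGroup V ℂ) {a : V → ℝ}

omit [DecidableEq V] in
theorem trace_anticomm_mul (A B C : Matrix V V ℂ) :
    (A * anticomm B C).trace = (anticomm B A * C).trace := by
  rw [anticomm, anticomm, Matrix.mul_add, Matrix.add_mul, trace_add, trace_add, add_comm,
    ← Matrix.mul_assoc, ← Matrix.mul_assoc, trace_mul_cycle]

include hU

omit [Fintype X] in
-- Conjugation by `exp (-iGt)` multiplies entry `(k,l)` by `exp (i(a_l - a_k)t)`; integrating
-- against `γ` gives its Fourier transform.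
theorem phiMap_eq_schurMul (hG : visHamiltonian Gv θ x = conjDiag U fun k => (a k : ℂ))
    (Y : Matrix V V ℂ) :
    phiMap Gv θ x Y = schurMul U (fun k l => tentFourier (a l - a k)) Y := by
  have key : ∀ (t : ℝ) (k l : V), Complex.exp (-(Complex.I * t) * a k) *
      Complex.exp (Complex.I * t * a l) = Complex.exp (Complex.I * (a l - a k : ℝ) * t) :=
    fun t k l => by
      rw [← Complex.exp_add]
      push_cast
      ring_nf
  simp only [phiMap, hG, smul_conjDiag, exp_conjDiag hU]
  rw [matIntegral_conjDiag hU tentDensity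
    (fun t k => Complex.exp (-(Complex.I * t) * a k))
    (fun t k => Complex.exp (Complex.I * t * a k))]
  · simp only [key, tentFourier]
  · intro k l
    simp only [key]
    exact integrable_mul_exp_I integrable_tentDensity _

omit [Fintype X] in
theorem trace_mul_phiMap (hG : visHamiltonian Gv θ x = conjDiag U fun k => (a k : ℂ))
    (A B : Matrix V V ℂ) : (A * phiMap Gv θ x B).trace = (phiMap Gv θ x A * B).trace := by
  rw [phiMap_eq_schurMul hU hG, phiMap_eq_schurMul hU hG, trace_mul_schurMul hU]
  congr 4
  funext k l
  rw [← tentFourier_neg, neg_sub]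

omit [Fintype X] in
theorem phiMap_exp_neg (hG : visHamiltonian Gv θ x = conjDiag U fun k => (a k : ℂ)) :
    phiMap Gv θ x (NormedSpace.exp (-visHamiltonian Gv θ x)) =
      NormedSpace.exp (-visHamiltonian Gv θ x) := by
  rw [phiMap_eq_schurMul hU hG, hG, ← neg_one_smul ℂ, smul_conjDiag, exp_conjDiag hU,
    schurMul_conjDiag hU]
  simp only [sub_self, tentFourier_zero, one_mul]

/-- The multiplier of the derivative of the logarithm at a matrix with eigenvalues `a`. -/
noncomputable def logMultiplier {V : Type*} (a : V → ℝ) (k l : V) : ℂ :=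
  Complex.exp (-(1 / 2) * Real.log (a k)) * Complex.exp (-(1 / 2) * Real.log (a l)) *
    logisticFourier ((Real.log (a l) - Real.log (a k)) / 2)

omit [Fintype V] [DecidableEq V] hU in
theorem logMultiplier_symm (a : V → ℝ) (k l : V) : logMultiplier a l k = logMultiplier a k l := by
  have h : (Real.log (a k) - Real.log (a l)) / 2 = -((Real.log (a l) - Real.log (a k)) / 2) := by
    ring
  rw [logMultiplier, logMultiplier, h, logisticFourier_neg,
    mul_comm (Complex.exp (_ * (Real.log (a l) : ℂ)))]

omit [Fintype V] [DecidableEq V] hU in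
theorem logMultiplier_self {a : V → ℝ} {k : V} (ha : 0 < a k) :
    logMultiplier a k k * a k = 1 := by
  have h : (a k : ℂ) = Complex.exp (Real.log (a k)) := by
    rw [← Complex.ofReal_exp, Real.exp_log ha]
  rw [logMultiplier, sub_self, zero_div, logisticFourier_zero, mul_one]
  conv_lhs => arg 2; rw [h]
  rw [← Complex.exp_add, ← Complex.exp_add]
  ring_nf
  simp

/-- Identifies the inner part of `Σ` with the derivative of the logarithm at `σ_v`. -/
theorem sandwich_upsilonMap (hlog : matLog (sigmaV e Gv θ) =
      conjDiag U fun k => (Real.log (a k) : ℂ)) (Y : Matrix V V ℂ) :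
    matPow (sigmaV e Gv θ) (-(1 / 2)) * upsilonMap e Gv θ Y * matPow (sigmaV e Gv θ) (-(1 / 2)) =
      schurMul U (logMultiplier a) Y := by
  have key : ∀ (t : ℝ) (k l : V), Complex.exp (-(Complex.I * t / 2) * Real.log (a k)) *
      Complex.exp (Complex.I * t / 2 * Real.log (a l)) =
      Complex.exp (Complex.I * ((Real.log (a l) - Real.log (a k)) / 2 : ℝ) * t) :=
    fun t k l => by
      rw [← Complex.exp_add]
      push_cast
      ring_nf
  simp only [upsilonMap, matPow, hlog, smul_conjDiag, exp_conjDiag hU]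
  rw [matIntegral_conjDiag hU logisticDensity
    (fun t k => Complex.exp (-(Complex.I * t / 2) * Real.log (a k)))
    (fun t k => Complex.exp (Complex.I * t / 2 * Real.log (a k))),
    conjDiag_mul_mul_conjDiag hU, schurMul_schurMul hU]
  · simp only [key]
    rfl
  · intro k l
    simp only [key]
    exact integrable_mul_exp_I integrable_logisticDensity _

theorem trace_mul_schurMul_logMultiplier (A B : Matrix V V ℂ) :
    (A * schurMul U (logMultiplier a) B).trace = (schurMul U (logMultiplier a) A * B).trace := by
  rw [trace_mul_schurMul hU]
  simp only [logMultiplier_symm]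

/-- The derivative of `ln` at `σ` in the direction `σ` is 1, as `ln ((1 + s)σ) = ln σ + ln (1 + s)`
suggests. -/
theorem schurMul_logMultiplier_self (ha : ∀ k, 0 < a k) :
    schurMul U (logMultiplier a) (conjDiag U fun k => (a k : ℂ)) = 1 := by
  rw [schurMul_conjDiag hU]
  simp only [logMultiplier_self (ha _)]
  rw [conjDiag, show (diagonal fun _ => 1 : Matrix V V ℂ) = 1 from diagonal_one, Matrix.mul_one,
    mem_unitaryGroup_iff.1 hU]

end Channels

/-! ### Derivatives along a coordinate of the parameter -/

section Derivatives

open scoped Matrix.Norms.L2Operator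

variable {V X : Type*} [Fintype V] [DecidableEq V] [Fintype X] {J : ℕ}
  {Gv : Fin J → X → Matrix V V ℂ}

omit [Fintype V] [DecidableEq V] [Fintype X] in
theorem visHamiltonian_update (θ : Fin J → ℝ) (j : Fin J) (s : ℝ) (x : X) :
    visHamiltonian Gv (Function.update θ j s) x =
      visHamiltonian Gv θ x + (s - θ j) • Gv j x := by
  have h : ∀ i, (Function.update θ j s i : ℂ) • Gv i x =
      (θ i : ℂ) • Gv i x + if i = j then (s - θ j) • Gv j x else 0 := fun i => by
    rcases eq_or_ne i j with rfl | hij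
    · rw [Function.update_self, if_pos rfl]
      ext k l
      simp
      ring
    · rw [Function.update_of_ne hij, if_neg hij, add_zero]
  simp only [visHamiltonian, h, sum_add_distrib]
  simp

omit [Fintype X] in
theorem hasDerivAt_exp_neg_visHamiltonian [Nonempty V] (hGv : ∀ j x, (Gv j x).IsHermitian)
    (θ : Fin J → ℝ) (j : Fin J) (x : X) :
    HasDerivAt (fun s => NormedSpace.exp (-visHamiltonian Gv (Function.update θ j s) x))
      (-((1 / 2 : ℂ) • anticomm (NormedSpace.exp (-visHamiltonian Gv θ x))
        (phiMap Gv θ x (Gv j x)))) (θ j) := by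
  obtain ⟨U, hU, hG, -⟩ := exists_spectral (isHermitian_visHamiltonian hGv θ x)
  set a := (isHermitian_visHamiltonian hGv θ x).eigenvalues
  have hneg : -visHamiltonian Gv θ x = conjDiag U fun k => ((-a k : ℝ) : ℂ) := by
    conv_lhs => rw [hG]
    rw [← neg_one_smul ℂ, smul_conjDiag]
    simp
  obtain ⟨L, hL, hLs⟩ := hasFDerivAt_exp_conjDiag hU fun k => -a k
  rw [← hneg] at hL
  have hpath : HasDerivAt (fun s => -visHamiltonian Gv (Function.update θ j s) x) (-Gv j x)
      (θ j) := by
    simp only [visHamiltonian_update]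
    exact ((((hasDerivAt_id (θ j)).sub_const (θ j)).smul_const (Gv j x)).const_add
      (visHamiltonian Gv θ x)).neg.congr_deriv (by simp)
  have hbase : -visHamiltonian Gv (Function.update θ j (θ j)) x = -visHamiltonian Gv θ x := by
    rw [Function.update_eq_self]
  have hcomp := (hL.restrictScalars ℝ).comp_hasDerivAt_of_eq (θ j) hpath hbase.symm
  refine hcomp.congr_deriv ?_
  change L (-Gv j x) = _
  rw [map_neg, hLs, hneg, exp_conjDiag hU, phiMap_eq_schurMul hU hG, anticomm_conjDiag hU,
    schurMul_schurMul hU, smul_schurMul]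
  congr 2
  funext k l
  rw [neg_sub_neg]
  ring

end Derivatives

end

section

open Matrix Finset MeasureTheory

/-! ### Gradient of the relative entropy -/

section Gradient

open scoped Matrix.Norms.L2Operator

variable {V H X : Type*} [Fintype V] [DecidableEq V] [Fintype H] [DecidableEq H] [Fintype X]
  {J : ℕ} {Gv : Fin J → X → Matrix V V ℂ}

theorem _root_.HasDerivAt.trace_mul_left {F : ℝ → Matrix V V ℂ} {F' : Matrix V V ℂ} {s : ℝ}
    (h : HasDerivAt F F' s) (A : Matrix V V ℂ) :
    HasDerivAt (fun t => (A * F t).trace) ((A * F').trace) s := by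
  let ℓ : Matrix V V ℂ →L[ℂ] ℂ :=
    ((Matrix.traceLinearMap V ℂ ℂ).comp (LinearMap.mulLeft ℂ A)).toContinuousLinearMap
  exact (ℓ.restrictScalars ℝ).hasFDerivAt.comp_hasDerivAt s h

/-- The derivative of `∑ x, exp (-G_v^x(θ))` with respect to `θ_j`. -/
noncomputable def gibbsDeriv (Gv : Fin J → X → Matrix V V ℂ) (θ : Fin J → ℝ) (j : Fin J) :
    Matrix V V ℂ :=
  ∑ x, -((1 / 2 : ℂ) • anticomm (NormedSpace.exp (-visHamiltonian Gv θ x))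
    (phiMap Gv θ x (Gv j x)))

theorem hasDerivAt_gibbsSum [Nonempty V] (hGv : ∀ j x, (Gv j x).IsHermitian)
    (θ : Fin J → ℝ) (j : Fin J) :
    HasDerivAt (fun s => gibbsSum Gv (Function.update θ j s)) (gibbsDeriv Gv θ j) (θ j) :=
  HasDerivAt.fun_sum fun x _ => hasDerivAt_exp_neg_visHamiltonian hGv θ j x

omit [Fintype X] in
theorem expval_phiMap_smul (hGv : ∀ j x, (Gv j x).IsHermitian) (θ : Fin J → ℝ) (x : X)
    (A Y : Matrix V V ℂ) (z : ℂ) :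
    z * expval A (phiMap Gv θ x Y) = expval A (phiMap Gv θ x (z • Y)) := by
  obtain ⟨U, hU, hG, -⟩ := exists_spectral (isHermitian_visHamiltonian hGv θ x)
  rw [expval, expval, trace_mul_phiMap hU hG, trace_mul_phiMap hU hG, Matrix.mul_smul, trace_smul,
    smul_eq_mul]

/-- Both the anticommutator and `Φ` are self-adjoint for the trace pairing, so they pass from
`G_v^{j,x}` to `R`. -/
theorem trace_mul_gibbsDeriv (hGv : ∀ j x, (Gv j x).IsHermitian) (θ : Fin J → ℝ) (j : Fin J)
    (R : Matrix V V ℂ) : (R * gibbsDeriv Gv θ j).trace =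
      -∑ x, expval (Gv j x) (phiMap Gv θ x
        ((1 / 2 : ℂ) • anticomm (NormedSpace.exp (-visHamiltonian Gv θ x)) R)) := by
  rw [gibbsDeriv, Matrix.mul_sum, trace_sum, ← sum_neg_distrib]
  refine sum_congr rfl fun x _ => ?_
  obtain ⟨U, hU, hG, -⟩ := exists_spectral (isHermitian_visHamiltonian hGv θ x)
  rw [← expval_phiMap_smul hGv, expval, Matrix.mul_neg, trace_neg, Matrix.mul_smul, trace_smul,
    trace_anticomm_mul, trace_mul_phiMap hU hG, trace_mul_comm, smul_eq_mul]

theorem trace_gibbsDeriv (hGv : ∀ j x, (Gv j x).IsHermitian) (θ : Fin J → ℝ) (j : Fin J) :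
    (gibbsDeriv Gv θ j).trace =
      -∑ x, expval (Gv j x) (NormedSpace.exp (-visHamiltonian Gv θ x)) := by
  have h := trace_mul_gibbsDeriv hGv θ j 1
  rw [Matrix.one_mul] at h
  rw [h]
  congr 1
  refine sum_congr rfl fun x _ => ?_
  obtain ⟨U, hU, hG, -⟩ := exists_spectral (isHermitian_visHamiltonian hGv θ x)
  have h2 : (1 / 2 : ℂ) • anticomm (NormedSpace.exp (-visHamiltonian Gv θ x)) 1 =
      NormedSpace.exp (-visHamiltonian Gv θ x) := by
    rw [anticomm, Matrix.mul_one, Matrix.one_mul, ← two_smul ℂ, smul_smul]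
    norm_num
  rw [h2, phiMap_exp_neg hU hG]

variable (e : OrthonormalBasis X ℂ (EuclideanSpace ℂ H))

theorem hasDerivAt_sigmaV [Nonempty V] [Nonempty X] (hGv : ∀ j x, (Gv j x).IsHermitian)
    (θ : Fin J → ℝ) (j : Fin J) :
    HasDerivAt (fun s => sigmaV e Gv (Function.update θ j s))
      ((gibbsSum Gv θ).trace⁻¹ • gibbsDeriv Gv θ j -
        ((gibbsSum Gv θ).trace⁻¹ * (gibbsDeriv Gv θ j).trace) • sigmaV e Gv θ) (θ j) := by
  have h2 := PosDef.trace_eq_ofReal (posDef_gibbsSum hGv θ)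
  have h3 : (gibbsSum Gv θ).trace ≠ 0 := by
    rw [← h2.2]; exact_mod_cast h2.1.ne'
  have hW := hasDerivAt_gibbsSum hGv θ j
  have hbase : gibbsSum Gv (Function.update θ j (θ j)) = gibbsSum Gv θ := by
    rw [Function.update_eq_self]
  have hZ := hW.trace_mul_left 1
  simp only [Matrix.one_mul] at hZ
  have hZinv := (hasDerivAt_inv h3).scomp_of_eq (θ j) hZ (by rw [hbase])
  simp only [sigmaV_eq]
  refine (hZinv.smul hW).congr_deriv ?_
  simp only [Function.comp_apply, hbase, smul_smul]
  rw [sub_eq_add_neg, ← neg_smul]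
  congr 2
  rw [smul_eq_mul]
  field_simp

omit [DecidableEq V] in
theorem ofReal_re_trace_mul_of_isHermitian {A B : Matrix V V ℂ} (hA : A.IsHermitian)
    (hB : B.IsHermitian) : ((A * B).trace.re : ℂ) = (A * B).trace := by
  refine Complex.conj_eq_iff_re.1 ?_
  have h := trace_conjTranspose (A * B)
  rw [conjTranspose_mul, hA.eq, hB.eq, trace_mul_comm] at h
  exact h.symm

theorem relEntropy_eq {ρ σ : Matrix V V ℂ} (hρ : ρ.IsHermitian) :
    (relEntropy ρ σ : ℂ) = (ρ * matLog ρ).trace - (ρ * matLog σ).trace := by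
  have h : ∀ A : Matrix V V ℂ, (matLog A).IsHermitian := fun A => cfc_predicate Real.log A
  rw [relEntropy, Complex.sub_re, Complex.ofReal_sub, ofReal_re_trace_mul_of_isHermitian hρ (h _),
    ofReal_re_trace_mul_of_isHermitian hρ (h _)]

theorem hasDerivAt_relEntropy_sigmaV [Nonempty V] [Nonempty X]
    (hGv : ∀ j x, (Gv j x).IsHermitian) {ρ : Matrix V V ℂ} (hρ : IsState ρ) (θ : Fin J → ℝ)
    (j : Fin J) :
    HasDerivAt (fun s : ℝ => ((relEntropy ρ (sigmaV e Gv (Function.update θ j s)) : ℝ) : ℂ))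
      ((∑ x, (prob e Gv θ x : ℂ) * expval (Gv j x) (sigmaMap e Gv θ x ρ)) -
        ∑ x, (prob e Gv θ x : ℂ) * expval (Gv j x) (sigmaVx Gv θ x)) (θ j) := by
  have hpos := posDef_sigmaV e hGv θ
  obtain ⟨U, hU, hσ, hcfc⟩ := exists_spectral hpos.1
  set a := hpos.1.eigenvalues
  have ha0 : ∀ k, 0 < a k := hpos.eigenvalues_pos
  -- Positive eigenvalues summing to 1 are at most 1, as the logarithmic series requires.
  have ha1 : ∀ k, a k ≤ 1 := fun k => by
    have h := trace_sigmaV e hGv θ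
    rw [hσ, trace_conjDiag hU] at h
    have h' : ∑ k, a k = 1 := by exact_mod_cast h
    exact h' ▸ single_le_sum (fun i _ => (ha0 i).le) (mem_univ k)
  have hlog := hasDerivAt_matLog (fun s => (posDef_sigmaV e hGv (Function.update θ j s)).1)
    (hasDerivAt_sigmaV e hGv θ j) hU (by rw [Function.update_eq_self]; exact hσ) ha0 ha1
  have hrel := (hlog.trace_mul_left ρ).const_sub ((ρ * matLog ρ).trace)
  simp only [relEntropy_eq hρ.1.1]
  refine hrel.congr_deriv ?_
  change -(ρ * schurMul U (logMultiplier a) _).trace = _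
  rw [trace_mul_schurMul_logMultiplier hU]
  set R := schurMul U (logMultiplier a) ρ with hR
  -- Moving the multiplier back onto `σ_v` turns `σ_v` into 1 and leaves `Tr ρ`.
  have hRσ : (R * sigmaV e Gv θ).trace = 1 := by
    rw [hσ, hR, ← trace_mul_schurMul_logMultiplier hU, schurMul_logMultiplier_self hU ha0,
      Matrix.mul_one, hρ.2]
  have hmap : ∀ x, sigmaMap e Gv θ x ρ =
      phiMap Gv θ x ((1 / 2 : ℂ) • anticomm (sigmaVx Gv θ x) R) := fun x => by
    rw [hR, ← sandwich_upsilonMap e hU (hcfc Real.log)]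
    rfl
  have hterm1 : ∀ x, (prob e Gv θ x : ℂ) * expval (Gv j x) (sigmaMap e Gv θ x ρ) =
      (gibbsSum Gv θ).trace⁻¹ * expval (Gv j x) (phiMap Gv θ x
        ((1 / 2 : ℂ) • anticomm (NormedSpace.exp (-visHamiltonian Gv θ x)) R)) := fun x => by
    have h : ∀ (z : ℂ) (A : Matrix V V ℂ), z • (1 / 2 : ℂ) • anticomm A R =
        (1 / 2 : ℂ) • anticomm (z • A) R := fun z A => by
      rw [smul_comm, anticomm, anticomm, Matrix.smul_mul, Matrix.mul_smul, smul_add]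
    rw [hmap, expval_phiMap_smul hGv, expval_phiMap_smul hGv, h, h, prob_smul_sigmaVx e hGv]
  have hterm2 : ∀ x, (prob e Gv θ x : ℂ) * expval (Gv j x) (sigmaVx Gv θ x) =
      (gibbsSum Gv θ).trace⁻¹ * expval (Gv j x) (NormedSpace.exp (-visHamiltonian Gv θ x)) :=
    fun x => by
      have h : ∀ (z : ℂ) (A B : Matrix V V ℂ), z * (A * B).trace = (A * (z • B)).trace :=
        fun z A B => by rw [Matrix.mul_smul, trace_smul, smul_eq_mul]
      rw [expval, expval, h, h, prob_smul_sigmaVx e hGv]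
  simp only [hterm1, hterm2]
  rw [Matrix.mul_sub, trace_sub, Matrix.mul_smul, Matrix.mul_smul, trace_smul, trace_smul, hRσ,
    trace_mul_gibbsDeriv hGv, trace_gibbsDeriv hGv, ← mul_sum, ← mul_sum]
  simp only [smul_eq_mul]
  ring

end Gradient

end

end QCBoltzmann

theorem mainTheorem3 {V H X : Type*} [Fintype V] [DecidableEq V] [Fintype H] [DecidableEq H]
    [Nonempty H] [Fintype X] {J : ℕ}
    (e : OrthonormalBasis X ℂ (EuclideanSpace ℂ H))
    (Gv : Fin J → X → Matrix V V ℂ) (hGv : ∀ j x, (Gv j x).IsHermitian)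
    (ρ : Matrix V V ℂ) (hρ : QCBoltzmann.IsState ρ) (θ : Fin J → ℝ) :
    QCBoltzmann.sigmaV e Gv θ =
        ∑ x, QCBoltzmann.prob e Gv θ x • QCBoltzmann.sigmaVx Gv θ x ∧
      ∀ j : Fin J,
        HasDerivAt
          (fun s : ℝ =>
            ((QCBoltzmann.relEntropy ρ
              (QCBoltzmann.sigmaV e Gv (Function.update θ j s)) : ℝ) : ℂ))
          ((∑ x, (QCBoltzmann.prob e Gv θ x : ℂ) *
              QCBoltzmann.expval (Gv j x) (QCBoltzmann.sigmaMap e Gv θ x ρ)) -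
            ∑ x, (QCBoltzmann.prob e Gv θ x : ℂ) *
              QCBoltzmann.expval (Gv j x) (QCBoltzmann.sigmaVx Gv θ x))
          (θ j) := by
  -- On an empty index type every trace is 0, contradicting `Tr ρ = 1`.
  have hV : Nonempty V := by
    by_contra h
    rw [not_nonempty_iff] at h
    have := hρ.2
    simp [Matrix.trace] at this
  have hX : Nonempty X := e.toBasis.index_nonempty
  exact ⟨QCBoltzmann.sigmaV_eq_sum_prob_smul e hGv θ,
    fun j => QCBoltzmann.hasDerivAt_relEntropy_sigmaV e hGv hρ θ j⟩
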